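/- Let $\Gamma$ be a graph with graph distance $d_\Gamma$, and suppose that there are $D\ge 1$, $C_\Gamma\ge 1$ and an injective map $\iota:\Gamma\to\mathbb R^D$ with $$C_\Gamma^{-1}|\iota(i)-\iota(j)|\le d_\Gamma(i,j)\le C_\Gamma|\iota(i)-\iota(j)|\qquad\text{for all } i,j\in\Gamma .$$ For finite $X\subset\Gamma$ let $\mathcal H_X=\bigotimes_{i\in X}\mathbb C^d$ and let $\mathcal A_X$ be the algebra of linear operators on $\mathcal H_X$, with $\mathcal A_X\subset\mathcal A_Y$ for $X\subset Y$ via $A\mapsto A\otimes \mathrm{Id}_{Y\setminus X}$. For a Hermitian operator $A$ put $\mathrm{gap}(A)=\inf(\mathrm{spec}\,A\setminus\{0\})$, with $\inf\emptyset=+\infty$. Let $\Phi$ assign to every finite $X\subset\Gamma$ a Hermitian operator $\Phi(X)\in\mathcal A_X$, such that: - for some $R>0$, $\Phi(X)=0$ whenever the diameter of $X$ in $d_\Gamma$ exceeds $R$; - $\Phi(X)\ge 0$ for all $X$, $\ \sup_X\|\Phi(X)\|<\infty$ and $\inf_{X:\Phi(X)\ne 0}\mathrm{gap}(\Phi(X))>0$;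 - for every finite $\Lambda\subset\Gamma$, the Hamiltonian $H_\Lambda=\sum_{X\subset\Lambda}\Phi(X)$ is frustration-free, that is, $\ker H_\Lambda\ne\{0\}$. Let $\tilde H_\Lambda=\sum_{X\subset\Lambda}h_X$, where $h_X$ is the orthogonal projection onto the range of $\Phi(X)$. For $k\in\mathbb N$ let $l_k=(3/2)^{k/D}$ and $R(k)=[0,l_{k+1}]\times\cdots\times[0,l_{k+D}]\subset\mathbb R^D$, and let $\mathcal F_k$ be the collection of all $\Lambda\subset\Gamma$ such that $\iota(\Lambda)$ is contained in $R(k)$ up to a translation and a permutation of the coordinates; such $\Lambda$ are finite. Put $$\mathrm{gap}_H(\mathcal F_k)=\inf_{\Lambda\in\mathcal F_k}\mathrm{gap}(H_\Lambda),\qquad \mathrm{gap}_H(\Gamma)=\inf_{k\ge1}\mathrm{gap}_H(\mathcal F_k),$$ and define $\mathrm{gap}_{\tilde H}(\mathcal F_k)$ and $\mathrm{gap}_{\tilde H}(\Gamma)$ in the same way with $\tilde H_\Lambda$ in place of $H_\Lambda$. **Proposition.** Let $\lambda_k\in(0,1)$ and $s_k>0$ ($k\ge1$) be real numbers such that $$\sum_{k\ge1}\frac1{s_k}<\infty\qquad\text{and}\qquad\liminf_{k\to\infty}\sqrt{\lambda_k}\,\frac{l_k}{k\,s_k}>0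 .$$ If $\mathrm{gap}_{H}(\mathcal F_k)\ge\lambda_k$ for all $k\ge1$, or if $\mathrm{gap}_{\tilde H}(\mathcal F_k)\ge\lambda_k$ for all $k\ge1$, then $\mathrm{gap}_{H}(\Gamma)>0$ and $\mathrm{gap}_{\tilde H}(\Gamma)>0$. -/

import Mathlib

open scoped ComplexOrder

noncomputable section

namespace SpinSystem

/-- The map `ι` is an injective bi-Lipschitz embedding, with constant `C`, of the graph `G`, with its
graph distance, into Euclidean space. -/
structure IsEuclideanEmbedding {V : Type*} (G : SimpleGraph V) {D : ℕ} (C : ℝ)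
    (ι : V → EuclideanSpace ℝ (Fin D)) : Prop where
  injective : Function.Injective ι
  lower : ∀ i j : V, C⁻¹ * ‖ι i - ι j‖ ≤ (G.dist i j : ℝ)
  upper : ∀ i j : V, (G.dist i j : ℝ) ≤ C * ‖ι i - ι j‖

/-- The diameter of a finite set of vertices in the graph distance. -/
def graphDiam {V : Type*} (G : SimpleGraph V) (X : Finset V) : ℕ :=
  (X ×ˢ X).sup (fun p => G.dist p.1 p.2)

/-- Labels of the product orthonormal basis of the Hilbert space of the region `X`, the tensor product
over the sites of `X` of copies of `ℂ^d`. -/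
abbrev Config {V : Type*} (d : ℕ) (X : Finset V) : Type _ := X → Fin d

/-- The algebra of linear operators on the Hilbert space of the region `X`, written as matrices in
the product orthonormal basis. -/
abbrev LocalOp {V : Type*} (d : ℕ) (X : Finset V) : Type _ :=
  Matrix (Config d X) (Config d X) ℂ

/-- The inclusion of local algebras for `X ⊆ Y`: the operator `A ⊗ Id` on the Hilbert space of `Y`,
with `Id` the identity on `Y \ X`. Its matrix element between `σ` and `τ` is that of `A` between the
restrictions to `X` if `σ` and `τ` agree on `Y \ X`, and is zero otherwise. -/
def extend {V : Type*} [DecidableEq V] {d : ℕ} {X Y : Finset V} (h : X ⊆ Y)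
    (A : LocalOp d X) : LocalOp d Y :=
  fun σ τ =>
    if ∀ i : Y, (i : V) ∉ X → σ i = τ i then
      A (fun i => σ ⟨i, h i.2⟩) (fun i => τ ⟨i, h i.2⟩)
    else 0

/-- The infimum of the nonzero spectrum; it is `⊤` if there is no nonzero spectrum. -/
def gapOp {n : Type*} [Fintype n] [DecidableEq n] (A : Matrix n n ℂ) : EReal :=
  ⨅ E ∈ spectrum ℝ A \ {0}, (E : EReal)

/-- The orthogonal projection onto the range of a matrix. -/
def rangeProj {n : Type*} [Fintype n] [DecidableEq n] (A : Matrix n n ℂ) : Matrix n n ℂ :=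
  Matrix.toEuclideanLin.symm
    ((LinearMap.range (Matrix.toEuclideanLin A)).starProjection :
      EuclideanSpace ℂ n →ₗ[ℂ] EuclideanSpace ℂ n)

/-- An interaction assigns to every finite region an operator on its Hilbert space. -/
abbrev Interaction (V : Type*) (d : ℕ) : Type _ := (X : Finset V) → LocalOp d X

/-- The supremum of the operator norms of the interaction terms. -/
def phiMax {V : Type*} [DecidableEq V] {d : ℕ} (Φ : Interaction V d) : EReal :=
  ⨆ X : Finset V, ((‖Matrix.toEuclideanCLM (𝕜 := ℂ) (Φ X)‖ : ℝ) : EReal)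

/-- The infimum of the gaps of the nonzero interaction terms. -/
def phiMin {V : Type*} [DecidableEq V] {d : ℕ} (Φ : Interaction V d) : EReal :=
  ⨅ (X : Finset V) (_ : Φ X ≠ 0), gapOp (Φ X)

/-- The interaction has range `R`, its terms are Hermitian and positive semidefinite, and they are
uniformly bounded from above and, on the complement of their kernels, away from zero. -/
structure IsAdmissible {V : Type*} [DecidableEq V] {d : ℕ} (G : SimpleGraph V) (R : ℝ)
    (Φ : Interaction V d) : Prop where
  finite_range : ∀ X : Finset V, R < (graphDiam G X : ℝ) → Φ X = 0
  posSemidef : ∀ X : Finset V, (Φ X).PosSemidef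
  phiMax_lt_top : phiMax Φ < ⊤
  phiMin_pos : 0 < phiMin Φ

/-- The Hamiltonian of the finite region `Λ`: the sum of all `Φ X` with `X ⊆ Λ`. -/
def hamiltonian {V : Type*} [DecidableEq V] {d : ℕ} (Φ : Interaction V d) (Λ : Finset V) :
    LocalOp d Λ :=
  ∑ X ∈ Λ.powerset.attach, extend (Finset.mem_powerset.mp X.2) (Φ X.1)

/-- Every finite-volume Hamiltonian has a nonzero kernel. -/
def IsFrustrationFree {V : Type*} [DecidableEq V] {d : ℕ} (Φ : Interaction V d) : Prop :=
  ∀ Λ : Finset V, LinearMap.ker (Matrix.toEuclideanLin (hamiltonian Φ Λ)) ≠ ⊥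

/-- Every interaction term is replaced by the orthogonal projection onto its range. -/
def projected {V : Type*} [DecidableEq V] {d : ℕ} (Φ : Interaction V d) : Interaction V d :=
  fun X => rangeProj (Φ X)

/-- The length scale `l_k = (3/2)^(k/D)`. -/
def scaleLength (D k : ℕ) : ℝ := (3 / 2 : ℝ) ^ ((k : ℝ) / (D : ℝ))

/-- The rectangle `R(k) = [0, l_{k+1}] × ⋯ × [0, l_{k+D}]`; its coordinates are indexed from `0`. -/
def rect (D k : ℕ) : Set (EuclideanSpace ℝ (Fin D)) :=
  {x | ∀ j : Fin D, x j ∈ Set.Icc 0 (scaleLength D (k + ((j : ℕ) + 1)))}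

/-- The family `F_k` of finite sets of vertices whose image under `ι` is contained in `R(k)` up to
a translation and a permutation of the coordinates. -/
def family {V : Type*} {D : ℕ} (ι : V → EuclideanSpace ℝ (Fin D)) (k : ℕ) : Set (Finset V) :=
  {Λ | ∃ (a : EuclideanSpace ℝ (Fin D)) (π : Equiv.Perm (Fin D)),
    ι '' (Λ : Set V) ⊆
      (fun x => a + LinearIsometryEquiv.piLpCongrLeft 2 ℝ ℝ π x) '' rect D k}

/-- `gap(F_k)`: the infimum of the gaps of the Hamiltonians of the regions in `F_k`. -/
def gapFamily {V : Type*} [DecidableEq V] {d D : ℕ} (Φ : Interaction V d)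
    (ι : V → EuclideanSpace ℝ (Fin D)) (k : ℕ) : EReal :=
  ⨅ Λ ∈ family ι k, gapOp (hamiltonian Φ Λ)

/-- `gap(Γ)`: the infimum over all `k ≥ 1` of `gap(F_k)`. -/
def gapInfinite {V : Type*} [DecidableEq V] {d D : ℕ} (Φ : Interaction V d)
    (ι : V → EuclideanSpace ℝ (Fin D)) : EReal :=
  ⨅ (k : ℕ) (_ : 1 ≤ k), gapFamily Φ ι k

end SpinSystem

end

/-! Each `Φ X` lies between two positive multiples of its range projection `h_X`, so `H` and `H̃`
have the same kernels and their gaps agree up to constant factors. It suffices to treat `H̃`, for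
which the energy of `x` in a region is `∑ ‖h_X x‖ ^ 2`.

The gap is passed from scale `k` to `k + 1`. The longest side of `R(k+1)` is `3/2 * l`, with `l =
l_{k+1}`. Two parts that overlap in a slab between `l/2` and `l` along that side both belong to
`F_k`. If their ground spaces are orthogonal up to `δ` off the common ground space, adding their gap
inequalities gives `γ (1 - δ) ‖x‖² ≤ E + E_overlap`. Averaging over `N` cuts with disjoint overlaps
bounds the excess by `E / N`, so the new gap is at least `N / (N + 1) * (1 - δ) * γ` (`gap_step`).

The bound on `δ` (`norm_inner_le_of_overlap`) uses the product `L` of all `1 - h_X`, arranged in two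
layers. By the detectability lemma (`sum_norm_sq_complProd_le`), `S = L* L` is at most `1 - η` off
the ground space, with `η` of the order of the a priori gap `λ`. By locality `⟨x, S^m y⟩ = ⟨x, y⟩`
while the light cone of `S^m` fits in the overlap. The same holds for `q(S)` if `q(1) = 1`, and a
Chebyshev polynomial of degree `n` gives `δ ≤ 2 exp(-n √η)`, with `√η` in place of `η` in the
exponent.

With about `s_k` cuts the overlaps have width of order `l_k / s_k`, so the exponent is of order
`√λ_k l_k / s_k`, which is at least a multiple of `k`. The relative loss per step is at most `1 /
s_k` plus an exponentially small term. This is summable, so the gap stays away from zero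
(`exists_pos_of_summable_loss`). -/

open scoped ComplexOrder

noncomputable section

namespace SpinSystem

/-! ### Chebyshev polynomials, the detectability lemma, polynomials of self-adjoint operators -/

section

open Polynomial InnerProductSpace

/-- A polynomial of degree at most `n` that is `1` at `1` and exponentially small on `[0, 1 - η]`,
at rate `√η`. -/
lemma exists_polynomial_small (η : ℝ) (hη0 : 0 < η) (hη1 : η < 1) (n : ℕ) :
    ∃ q : ℝ[X], q.natDegree ≤ n ∧ q.eval 1 = 1 ∧
      ∀ x ∈ Set.Icc 0 (1 - η), |q.eval x| ≤ 2 * Real.exp (-(n * √η)) := by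
  have h1 : 0 < 1 - η := by linarith
  -- The map `x ↦ 2x / (1 - η) - 1` carries `[0, 1 - η]` to `[-1, 1]`, where `T n` is bounded by
  -- `1`, and carries `1` to `y = cosh u`. As `u ≥ √η`, the value `T n y = cosh (n u)` is at least
  -- `exp (n √η) / 2`.
  set y : ℝ := 2 / (1 - η) - 1 with hy
  have hy1 : Real.cosh √η ≤ y := by
    refine (Real.cosh_le_exp_half_sq _).trans ?_
    rw [Real.sq_sqrt hη0.le]
    have h2 : Real.exp (η / 2) ≤ 1 / (1 - η / 2) := by
      rw [le_div_iff₀ (by linarith), ← le_div_iff₀' (Real.exp_pos _), one_div, ← Real.exp_neg]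
      linarith [Real.add_one_le_exp (-(η / 2))]
    refine h2.trans ?_
    rw [hy, div_sub_one h1.ne', div_le_div_iff₀ (by linarith) h1]
    nlinarith
  have hy2 : 1 ≤ y := (Real.one_le_cosh _).trans hy1
  set u := Real.arcosh y with hu
  have hyu : Real.cosh u = y := Real.cosh_arcosh hy2
  have hu0 : 0 ≤ u := Real.arcosh_nonneg hy2
  have hu1 : √η ≤ u := by
    rw [← hyu] at hy1
    rwa [Real.cosh_le_cosh, abs_of_nonneg (Real.sqrt_nonneg _), abs_of_nonneg hu0] at hy1
  have hT : Real.exp (n * √η) / 2 ≤ (Chebyshev.T ℝ n).eval y := by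
    rw [← hyu, Chebyshev.T_real_cosh, Real.cosh_eq]
    have h3 : Real.exp (n * √η) ≤ Real.exp (((n : ℤ) : ℝ) * u) := by
      apply Real.exp_le_exp.mpr
      push_cast
      gcongr
    linarith [Real.exp_pos (-(((n : ℤ) : ℝ) * u))]
  have hT0 : 0 < (Chebyshev.T ℝ n).eval y := lt_of_lt_of_le (by positivity) hT
  refine ⟨C ((Chebyshev.T ℝ n).eval y)⁻¹ *
    (Chebyshev.T ℝ n).comp (C (2 / (1 - η)) * X - C 1), ?_, ?_, ?_⟩
  · refine (natDegree_C_mul_le _ _).trans (natDegree_comp_le.trans ?_)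
    rw [Chebyshev.natDegree_T]
    have : (C (2 / (1 - η)) * X - C 1 : ℝ[X]).natDegree ≤ 1 := by
      rw [natDegree_sub_C]
      simpa using natDegree_C_mul_le (2 / (1 - η)) (X : ℝ[X])
    simpa using Nat.mul_le_mul_left n this
  · simp only [eval_mul, eval_C, eval_comp, eval_sub, eval_X, mul_one]
    rw [← hy]
    exact inv_mul_cancel₀ hT0.ne'
  · rintro x ⟨hx0, hx1⟩
    simp only [eval_mul, eval_C, eval_comp, eval_sub, eval_X]
    rw [abs_mul, abs_inv, abs_of_pos hT0]
    have h4 : |(Chebyshev.T ℝ n).eval (2 / (1 - η) * x - 1)| ≤ 1 := by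
      apply Chebyshev.abs_eval_T_real_le_one
      have h5 : 0 ≤ 2 / (1 - η) * x := by positivity
      have h6 : 2 / (1 - η) * x ≤ 2 := by
        rw [div_mul_eq_mul_div, div_le_iff₀ h1]
        linarith
      rw [abs_le]
      constructor <;> linarith
    have h7 : ((Chebyshev.T ℝ n).eval y)⁻¹ ≤ 2 * Real.exp (-(n * √η)) := by
      rw [Real.exp_neg, inv_le_comm₀ hT0 (by positivity), mul_inv, inv_inv]
      linarith
    calc _ ≤ 2 * Real.exp (-(n * √η)) * 1 := by gcongr
      _ = _ := mul_one _

set_option linter.unusedSectionVars false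

variable {E : Type*} [NormedAddCommGroup E] [InnerProductSpace ℂ E] [CompleteSpace E]

lemma inner_selfAdjoint_apply {T : E →L[ℂ] E} (hT : IsSelfAdjoint T) (x y : E) :
    inner ℂ (T x) y = inner ℂ x (T y) := by
  rw [← ContinuousLinearMap.adjoint_inner_right, hT.adjoint_eq]

lemma re_inner_starProjection_apply {p : E →L[ℂ] E} (hp : IsStarProjection p) (x : E) :
    (inner ℂ x (p x)).re = ‖p x‖ ^ 2 := by
  have h : p (p x) = p x := congrArg (fun T : E →L[ℂ] E => T x) hp.isIdempotentElem
  rw [← h, ← inner_selfAdjoint_apply hp.isSelfAdjoint, h]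
  exact inner_self_eq_norm_sq (𝕜 := ℂ) _

lemma norm_sq_one_sub_apply {p : E →L[ℂ] E} (hp : IsStarProjection p) (x : E) :
    ‖(1 - p) x‖ ^ 2 = ‖x‖ ^ 2 - ‖p x‖ ^ 2 := by
  have h := re_inner_starProjection_apply hp x
  have h2 := @norm_sub_sq ℂ E _ _ _ x (p x)
  simp only [sub_apply, one_apply_eq_self]
  rw [h2]
  simp only [RCLike.re_to_complex]
  rw [h]
  ring

lemma norm_one_sub_apply_le {p : E →L[ℂ] E} (hp : IsStarProjection p) (x : E) :
    ‖(1 - p) x‖ ≤ ‖x‖ := by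
  refine le_of_sq_le_sq ?_ (norm_nonneg _)
  rw [norm_sq_one_sub_apply hp]
  linarith [sq_nonneg ‖p x‖]

/-- The product of the operators `1 - h i` along a list. -/
def complProd {I : Type*} (h : I → E →L[ℂ] E) (l : List I) : E →L[ℂ] E :=
  (l.map fun i => 1 - h i).prod

lemma complProd_cons {I : Type*} (h : I → E →L[ℂ] E) (a : I) (l : List I) :
    complProd h (a :: l) = (1 - h a) * complProd h l := by
  simp [complProd]

open Classical in
/-- A list of projections: the energy lost along the product controls the energy that is left. -/
lemma exists_energy_bound {I : Type*} {h : I → E →L[ℂ] E}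
    (hp : ∀ i, IsStarProjection (h i)) (x : E) (l : List I) (hl : l.Nodup) :
    ∃ D : I → ℝ, (∀ i, 0 ≤ D i) ∧
      ∑ i ∈ l.toFinset, D i ^ 2 = ‖x‖ ^ 2 - ‖complProd h l x‖ ^ 2 ∧
      ∀ m ∈ l, ‖h m (complProd h l x)‖ ≤
        ∑ j ∈ l.toFinset.filter (fun j => ¬ Commute (h m) (h j)), D j := by
  induction l with
  | nil => exact ⟨fun _ => 0, fun _ => le_rfl, by simp [complProd], by simp⟩
  | cons a l ih =>
    obtain ⟨ha, hl⟩ := List.nodup_cons.mp hl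
    obtain ⟨D, hD0, hD1, hD2⟩ := ih hl
    set θ := complProd h l x with hθ
    have hθ' : complProd h (a :: l) x = (1 - h a) θ := by
      rw [complProd_cons, mul_apply_eq_comp]
    have ha' : a ∉ l.toFinset := by simpa using ha
    have hup : ∀ j ∈ l.toFinset, Function.update D a ‖h a θ‖ j = D j := fun j hj =>
      Function.update_of_ne (fun e : j = a => ha' (e ▸ hj)) _ _
    have hnn : ∀ i, 0 ≤ Function.update D a ‖h a θ‖ i := by
      intro i
      by_cases hi : i = a
      · subst hi; simp
      · rw [Function.update_of_ne hi]; exact hD0 i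
    -- `D a` is the norm that the factor `1 - h a` removes. The energy in `h m` is zero just after
    -- the factor of `m` has acted. Later factors that commute with `h m` do not raise it, and any
    -- other raises its norm by at most its own `D`.
    refine ⟨Function.update D a ‖h a θ‖, hnn, ?_, ?_⟩
    · rw [List.toFinset_cons, Finset.sum_insert ha', hθ', norm_sq_one_sub_apply (hp a),
        Function.update_self, Finset.sum_congr rfl fun j hj => by rw [hup j hj], hD1]
      ring
    · intro m hm
      rw [hθ']
      rcases List.mem_cons.mp hm with rfl | hm
      · have h0 : h m ((1 - h m) θ) = 0 := by
          have : h m * (1 - h m) = 0 := by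
            rw [mul_sub, mul_one, (hp m).isIdempotentElem.eq, sub_self]
          simpa using congrArg (fun T : E →L[ℂ] E => T θ) this
        rw [h0, norm_zero]
        exact Finset.sum_nonneg fun j _ => hnn j
      · have hsum : ∑ j ∈ l.toFinset.filter (fun j => ¬ Commute (h m) (h j)),
            Function.update D a ‖h a θ‖ j =
            ∑ j ∈ l.toFinset.filter (fun j => ¬ Commute (h m) (h j)), D j :=
          Finset.sum_congr rfl fun j hj => hup j (Finset.mem_filter.mp hj).1
        rw [List.toFinset_cons, Finset.filter_insert]
        by_cases hc : Commute (h m) (h a)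
        · rw [if_neg (not_not.mpr hc), hsum]
          have h1 : h m ((1 - h a) θ) = (1 - h a) (h m θ) := by
            have : Commute (h m) (1 - h a) := (Commute.one_right _).sub_right hc
            exact congrArg (fun T : E →L[ℂ] E => T θ) this.eq
          rw [h1]
          exact (norm_one_sub_apply_le (hp a) _).trans (hD2 m hm)
        · rw [if_pos hc, Finset.sum_insert (fun hmem => ha' (Finset.mem_filter.mp hmem).1), hsum,
            Function.update_self]
          have h1 : h m ((1 - h a) θ) = h m θ - h m (h a θ) := by simp
          have h2 : ‖h m (h a θ)‖ ≤ ‖h a θ‖ := by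
            refine le_of_sq_le_sq ?_ (norm_nonneg _)
            have := norm_sq_one_sub_apply (hp m) (h a θ)
            nlinarith [sq_nonneg ‖(1 - h m) (h a θ)‖]
          rw [h1]
          refine (norm_sub_le _ _).trans ?_
          linarith [hD2 m hm]

open Classical in
/-- The detectability lemma, in terms of the total energy. -/
lemma sum_norm_sq_complProd_le {I : Type*} {h : I → E →L[ℂ] E}
    (hp : ∀ i, IsStarProjection (h i)) (x : E) (l : List I) (hl : l.Nodup) (g : ℕ)
    (hg : ∀ m ∈ l, (l.toFinset.filter (fun j => ¬ Commute (h m) (h j))).card ≤ g) :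
    ∑ m ∈ l.toFinset, ‖h m (complProd h l x)‖ ^ 2 ≤
      (g : ℝ) ^ 2 * (‖x‖ ^ 2 - ‖complProd h l x‖ ^ 2) := by
  obtain ⟨D, hD0, hD1, hD2⟩ := exists_energy_bound hp x l hl
  calc ∑ m ∈ l.toFinset, ‖h m (complProd h l x)‖ ^ 2
      ≤ ∑ m ∈ l.toFinset,
          (g : ℝ) * ∑ j ∈ l.toFinset.filter (fun j => ¬ Commute (h m) (h j)), D j ^ 2 := by
        refine Finset.sum_le_sum fun m hm => ?_
        have hm' : m ∈ l := by simpa using hm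
        calc ‖h m (complProd h l x)‖ ^ 2
            ≤ (∑ j ∈ l.toFinset.filter (fun j => ¬ Commute (h m) (h j)), D j) ^ 2 := by
              gcongr
              exact hD2 m hm'
          _ ≤ _ := sq_sum_le_card_mul_sum_sq
          _ ≤ _ := mul_le_mul_of_nonneg_right (Nat.cast_le.mpr (hg m hm'))
              (Finset.sum_nonneg fun j _ => sq_nonneg _)
    -- Non-commutation is symmetric, so after exchanging the sums each `D j ^ 2` again occurs at
    -- most `g` times. This is the second factor `g`.
    _ = (g : ℝ) * ∑ j ∈ l.toFinset,
          ((l.toFinset.filter (fun m => ¬ Commute (h j) (h m))).card : ℝ) * D j ^ 2 := by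
        rw [← Finset.mul_sum]
        congr 1
        simp_rw [Finset.sum_filter]
        rw [Finset.sum_comm]
        refine Finset.sum_congr rfl fun j _ => ?_
        rw [← Finset.sum_filter, Finset.sum_const, nsmul_eq_mul]
        simp_rw [Commute.symm_iff (a := h j)]
    _ ≤ (g : ℝ) * ∑ j ∈ l.toFinset, (g : ℝ) * D j ^ 2 := by
        gcongr with j hj
        exact hg j (by simpa using hj)
    _ = _ := by
        rw [← Finset.mul_sum, hD1]
        ring

lemma complProd_apply_of_ker {I : Type*} {h : I → E →L[ℂ] E} {x : E} (l : List I)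
    (hx : ∀ i ∈ l, h i x = 0) : complProd h l x = x := by
  induction l with
  | nil => simp [complProd]
  | cons a l ih =>
    rw [complProd_cons, mul_apply_eq_comp, ih fun i hi => hx i (by simp [hi])]
    simp [hx a (by simp)]

lemma star_complProd {I : Type*} {h : I → E →L[ℂ] E} (hp : ∀ i, IsStarProjection (h i))
    (l : List I) : star (complProd h l) = complProd h l.reverse := by
  induction l with
  | nil => simp [complProd]
  | cons a l ih =>
    rw [complProd_cons, star_mul, ih]
    simp [complProd, (hp a).isSelfAdjoint.star_eq]

lemma complProd_append {I : Type*} (h : I → E →L[ℂ] E) (l l' : List I) :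
    complProd h (l ++ l') = complProd h l * complProd h l' := by
  simp [complProd]

/-- Polynomials in a self-adjoint operator, on an invariant subspace on which its quadratic form
takes values in `[0, 1 - η]`. -/
lemma norm_inner_aeval_le {S : E →L[ℂ] E} (hS : IsSelfAdjoint S) (W : Submodule ℂ E)
    [W.HasOrthogonalProjection] (hW : ∀ x ∈ W, S x ∈ W) (η : ℝ)
    (h0 : ∀ x ∈ W, 0 ≤ (inner ℂ x (S x)).re)
    (h1 : ∀ x ∈ W, (inner ℂ x (S x)).re ≤ (1 - η) * ‖x‖ ^ 2) (hη : η ≤ 1) (q : ℝ[X]) (ε : ℝ)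
    (hε : 0 ≤ ε)
    (hq : ∀ x ∈ Set.Icc 0 (1 - η), |q.eval x| ≤ ε) (x y : E) (hy : y ∈ W) :
    ‖inner ℂ x (aeval S q y)‖ ≤ ε * (‖x‖ * ‖y‖) := by
  set P : E →L[ℂ] E := W.starProjection with hP
  have hPsa : IsSelfAdjoint P := isSelfAdjoint_starProjection W
  have hPm : ∀ z, P z ∈ W := fun z => W.starProjection_apply_mem z
  have hPx : ∀ z ∈ W, P z = z := fun z hz => W.starProjection_eq_self_iff.mpr hz
  have hPn : ∀ z, ‖P z‖ ≤ ‖z‖ := fun z => W.norm_starProjection_apply_le z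
  -- The form bound on `S` holds only on `W`. The compression to `W` satisfies it everywhere, so its
  -- spectrum lies in `[0, 1 - η]`. Its powers agree with those of `S` on the invariant subspace
  -- `W`.
  set T : E →L[ℂ] E := P * S * P with hT
  have hTsa : IsSelfAdjoint T := by
    rw [isSelfAdjoint_iff, hT]
    simp [hPsa.star_eq, hS.star_eq, mul_assoc]
  have hTi : ∀ z, inner ℂ z (T z) = inner ℂ (P z) (S (P z)) := fun z => by
    rw [hT]
    simp only [mul_apply_eq_comp]
    rw [← inner_selfAdjoint_apply hPsa]
  have hT0 : 0 ≤ T := by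
    rw [ContinuousLinearMap.nonneg_iff_isPositive, ContinuousLinearMap.isPositive_def']
    refine ⟨hTsa, fun z => ?_⟩
    rw [ContinuousLinearMap.reApplyInnerSelf_apply, ← inner_re_symm, hTi]
    exact h0 _ (hPm z)
  have hT1 : T ≤ algebraMap ℝ (E →L[ℂ] E) (1 - η) := by
    rw [ContinuousLinearMap.le_def, ContinuousLinearMap.isPositive_def']
    refine ⟨((IsSelfAdjoint.all (1 - η)).algebraMap _).sub hTsa, fun z => ?_⟩
    rw [ContinuousLinearMap.reApplyInnerSelf_apply, ← inner_re_symm]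
    rw [sub_apply, inner_sub_right, hTi, RCLike.re_to_complex, Complex.sub_re]
    have h2 : (inner ℂ z ((algebraMap ℝ (E →L[ℂ] E) (1 - η)) z)).re = (1 - η) * ‖z‖ ^ 2 := by
      rw [Algebra.algebraMap_eq_smul_one]
      simp only [smul_apply, one_apply_eq_self]
      rw [← Complex.coe_smul, inner_smul_right, Complex.re_ofReal_mul]
      exact congrArg _ (inner_self_eq_norm_sq (𝕜 := ℂ) z)
    have h3 := h1 _ (hPm z)
    have h4 := hPn z
    have h5 : (1 - η) * ‖P z‖ ^ 2 ≤ (1 - η) * ‖z‖ ^ 2 := by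
      have : 0 ≤ 1 - η := by linarith
      gcongr
    rw [h2]
    linarith
  have hspec : ∀ r ∈ spectrum ℝ T, r ∈ Set.Icc 0 (1 - η) := fun r hr =>
    ⟨spectrum_nonneg_of_nonneg hT0 hr, (le_algebraMap_iff_spectrum_le hTsa).mp hT1 r hr⟩
  have hnorm : ‖aeval T q‖ ≤ ε := by
    rw [← cfc_polynomial q T hTsa]
    exact norm_cfc_le hε fun r hr => hq r (hspec r hr)
  have hpow : ∀ m : ℕ, (T ^ m) y = (S ^ m) y ∧ (S ^ m) y ∈ W := by
    intro m
    induction m with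
    | zero => simpa using hy
    | succ m ih =>
      rw [pow_succ', pow_succ', mul_apply_eq_comp, mul_apply_eq_comp, ih.1]
      refine ⟨?_, hW _ ih.2⟩
      simp only [mul_apply_eq_comp]
      rw [hPx _ ih.2, hPx _ (hW _ ih.2)]
  have hae : aeval S q y = aeval T q y := by
    rw [aeval_eq_sum_range, aeval_eq_sum_range]
    simp only [sum_apply, smul_apply, (hpow _).1]
  rw [hae]
  calc _ ≤ ‖x‖ * ‖aeval T q y‖ := norm_inner_le_norm _ _
    _ ≤ ‖x‖ * (ε * ‖y‖) := by
      gcongr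
      exact (aeval T q).le_of_opNorm_le hnorm y
    _ = _ := by ring

end

/-! ### Light cones and the almost orthogonality of ground spaces -/

section

open Polynomial InnerProductSpace

set_option linter.unusedSectionVars false

variable {E : Type*} [NormedAddCommGroup E] [InnerProductSpace ℂ E] [CompleteSpace E]

/-- Products of the operators `1 - h i` whose block lies to the left of `c`. -/
def coneMonoid {I : Type*} (h : I → E →L[ℂ] E) (s : Finset I) (b : I → ℤ) (c : ℤ) :
    Submonoid (E →L[ℂ] E) :=
  Submonoid.closure ((fun i => 1 - h i) '' {i | i ∈ s ∧ b i < c})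

/-- One layer of operators in blocks of the same parity enlarges the light cone by one block. -/
lemma exists_coneMonoid_layer {I : Type*} {h : I → E →L[ℂ] E} {s : Finset I} {b : I → ℤ}
    (hcomm : ∀ i ∈ s, ∀ j ∈ s, b i + 2 ≤ b j → Commute (h i) (h j)) {β c : ℤ} (hβ : β ≤ c) {y : E}
    (hy : ∀ i ∈ s, β ≤ b i → h i y = 0) (p : ℤ) (l : List I)
    (hl : ∀ i ∈ l, i ∈ s ∧ b i % 2 = p) {W : E →L[ℂ] E} (hW : W ∈ coneMonoid h s b c) :
    ∃ W' ∈ coneMonoid h s b (c + 1), complProd h l (W y) = W' y := by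
  -- Block `c` is admitted only if it has the parity of the layer. A factor of the layer beyond
  -- block `c` is then at least two blocks from all of `J`, so it passes through to `y` and acts
  -- trivially there.
  set J : Set I := {i | i ∈ s ∧ (b i < c ∨ (b i = c ∧ b i % 2 = p))}
  set M : Submonoid (E →L[ℂ] E) := Submonoid.closure ((fun i => 1 - h i) '' J)
  have h1 : coneMonoid h s b c ≤ M :=
    Submonoid.closure_mono (Set.image_mono fun i hi => ⟨hi.1, Or.inl hi.2⟩)
  have h2 : M ≤ coneMonoid h s b (c + 1) := by
    refine Submonoid.closure_mono (Set.image_mono fun i hi => ⟨hi.1, ?_⟩)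
    rcases hi.2 with h3 | h3
    · linarith
    · linarith [h3.1]
  suffices H : ∃ W' ∈ M, complProd h l (W y) = W' y by
    obtain ⟨W', hW', e⟩ := H
    exact ⟨W', h2 hW', e⟩
  induction l with
  | nil => exact ⟨W, h1 hW, by simp [complProd]⟩
  | cons a l ih =>
    obtain ⟨W', hW', e⟩ := ih fun i hi => hl i (by simp [hi])
    obtain ⟨has, hap⟩ := hl a (by simp)
    rw [complProd_cons, mul_apply_eq_comp, e]
    by_cases hac : b a ≤ c
    · refine ⟨(1 - h a) * W', M.mul_mem (Submonoid.subset_closure ⟨a, ⟨has, ?_⟩, rfl⟩) hW', rfl⟩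
      rcases hac.lt_or_eq with h3 | h3
      · exact Or.inl h3
      · exact Or.inr ⟨h3, hap⟩
    · refine ⟨W', hW', ?_⟩
      have hc : Commute (1 - h a) W' := by
        refine Submonoid.closure_induction (motive := fun T _ => Commute (1 - h a) T) ?_
          (Commute.one_right _) (fun _ _ _ _ h3 h4 => h3.mul_right h4) hW'
        rintro _ ⟨j, ⟨hjs, hj⟩, rfl⟩
        have h3 : Commute (h a) (h j) := by
          refine (hcomm j hjs a has ?_).symm
          rcases hj with h4 | ⟨h4, h5⟩ <;> omega
        exact (Commute.one_left _).sub_left ((Commute.one_right _).sub_right h3)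
      have h3 : (1 - h a) (W' y) = W' ((1 - h a) y) :=
        congrArg (fun T : E →L[ℂ] E => T y) hc.eq
      rw [h3]
      simp [hy a has (by omega)]

/-- Every generator `1 - h j` is self-adjoint and fixes `x`, so it can be absorbed into the left
vector. -/
lemma inner_coneMonoid_apply {I : Type*} {h : I → E →L[ℂ] E} (hp : ∀ i, IsStarProjection (h i))
    {s : Finset I} {b : I → ℤ} {c : ℤ} {x : E} (hx : ∀ i ∈ s, b i < c → h i x = 0)
    {W : E →L[ℂ] E} (hW : W ∈ coneMonoid h s b c) (z : E) :
    inner ℂ x (W z) = inner ℂ x z := by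
  refine Submonoid.closure_induction
    (motive := fun (T : E →L[ℂ] E) _ => ∀ z, inner ℂ x (T z) = inner ℂ x z) ?_ (fun z => rfl)
    (fun T T' _ _ h3 h4 z => (h3 _).trans (h4 z)) hW z
  rintro _ ⟨j, ⟨hjs, hj⟩, rfl⟩ z
  simp only [sub_apply, one_apply_eq_self, inner_sub_right]
  rw [← inner_selfAdjoint_apply (hp j).isSelfAdjoint, hx j hjs hj, inner_zero_left, sub_zero]

open Classical in
/-- Two vectors that are annihilated by the projections on either side of a wide overlap, and are
orthogonal to the common kernel, are almost orthogonal. -/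
theorem norm_inner_le_of_overlap {I : Type*} {h : I → E →L[ℂ] E}
    (hp : ∀ i, IsStarProjection (h i)) (s : Finset I) (b : I → ℤ)
    (hcomm : ∀ i ∈ s, ∀ j ∈ s, b i + 2 ≤ b j → Commute (h i) (h j))
    (K : Submodule ℂ E) [Kᗮ.HasOrthogonalProjection] (hK : ∀ x, x ∈ K ↔ ∀ i ∈ s, h i x = 0)
    (lam : ℝ) (hlam : 0 < lam)
    (hgap : ∀ x ∈ Kᗮ, lam * ‖x‖ ^ 2 ≤ ∑ i ∈ s, ‖h i x‖ ^ 2)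
    (g : ℕ) (hg1 : 1 ≤ g)
    (hg : ∀ m ∈ s, (s.filter (fun j => ¬ Commute (h m) (h j))).card ≤ g)
    (β : ℤ) (n : ℕ) {x y : E} (hy : ∀ i ∈ s, β ≤ b i → h i y = 0)
    (hx : ∀ i ∈ s, b i < β + 4 * n → h i x = 0) (hyK : y ∈ Kᗮ) :
    ‖inner ℂ x y‖ ≤ 2 * Real.exp (-(n * √(lam / (g ^ 2 + lam)))) * (‖x‖ * ‖y‖) := by
  -- Two layers, even and odd blocks. Terms of different blocks within a layer commute, so a layer
  -- moves the light cone by one block however many factors it has.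
  set l0 : List I := (s.filter fun i => b i % 2 = 0).toList with hl0
  set l1 : List I := (s.filter fun i => b i % 2 = 1).toList with hl1
  have hm0 : ∀ i ∈ l0, i ∈ s ∧ b i % 2 = 0 := by simp [hl0]
  have hm1 : ∀ i ∈ l1, i ∈ s ∧ b i % 2 = 1 := by simp [hl1]
  have hnd : (l0 ++ l1).Nodup := by
    refine List.Nodup.append (Finset.nodup_toList _) (Finset.nodup_toList _) ?_
    intro i hi hi'
    have := (hm0 i hi).2
    have := (hm1 i hi').2
    omega
  have hls : (l0 ++ l1).toFinset = s := by
    ext i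
    simp only [hl0, hl1, List.toFinset_append, Finset.toList_toFinset, Finset.mem_union,
      Finset.mem_filter]
    constructor
    · rintro (h3 | h3) <;> exact h3.1
    · intro h3
      rcases Int.emod_two_eq_zero_or_one (b i) with h4 | h4
      · exact Or.inl ⟨h3, h4⟩
      · exact Or.inr ⟨h3, h4⟩
  have hmem : ∀ i ∈ l0 ++ l1, i ∈ s := fun i hi => by
    rw [← hls]; simpa using hi
  set L := complProd h (l0 ++ l1) with hL
  set S := star L * L with hS
  have hSsa : IsSelfAdjoint S := IsSelfAdjoint.star_mul_self L
  have hStar : star L = complProd h (l0 ++ l1).reverse := star_complProd hp _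
  have hLK : ∀ z ∈ K, L z = z := fun z hz =>
    complProd_apply_of_ker _ fun i hi => (hK z).mp hz i (hmem i hi)
  have hLK' : ∀ z ∈ K, star L z = z := fun z hz => by
    rw [hStar]
    exact complProd_apply_of_ker _ fun i hi => (hK z).mp hz i (hmem i (List.mem_reverse.mp hi))
  have hLperp : ∀ z ∈ Kᗮ, L z ∈ Kᗮ := by
    intro z hz
    rw [Submodule.mem_orthogonal] at hz ⊢
    intro u hu
    rw [← ContinuousLinearMap.adjoint_inner_left, ← ContinuousLinearMap.star_eq_adjoint,
      hLK' u hu]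
    exact hz u hu
  have hLperp' : ∀ z ∈ Kᗮ, star L z ∈ Kᗮ := by
    intro z hz
    rw [Submodule.mem_orthogonal] at hz ⊢
    intro u hu
    rw [ContinuousLinearMap.star_eq_adjoint, ContinuousLinearMap.adjoint_inner_right, hLK u hu]
    exact hz u hu
  have hSi : ∀ z, (inner ℂ z (S z)).re = ‖L z‖ ^ 2 := fun z => by
    rw [hS, mul_apply_eq_comp, ContinuousLinearMap.star_eq_adjoint,
      ContinuousLinearMap.adjoint_inner_right]
    exact inner_self_eq_norm_sq (𝕜 := ℂ) _
  have hg0 : (1 : ℝ) ≤ g := by exact_mod_cast hg1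
  have hgl : 0 < (g : ℝ) ^ 2 + lam := by positivity
  -- The gap applied to `L z` and the detectability lemma give `lam ‖L z‖² ≤ g² (‖z‖² - ‖L z‖²)`.
  -- Solving for `‖L z‖²` produces the factor `g² / (g² + lam) = 1 - η`.
  set η := lam / (g ^ 2 + lam) with hη
  have hη0 : 0 < η := by positivity
  have hη1 : η < 1 := by
    rw [hη, div_lt_one hgl]
    nlinarith
  have hdl : ∀ z ∈ Kᗮ, ‖L z‖ ^ 2 ≤ (1 - η) * ‖z‖ ^ 2 := by
    intro z hz
    have h3 := sum_norm_sq_complProd_le hp z (l0 ++ l1) hnd g (by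
      rw [hls]; exact fun m hm => hg m (hmem m hm))
    rw [hls, ← hL] at h3
    have h4 := hgap _ (hLperp z hz)
    have h5 : 1 - η = g ^ 2 / (g ^ 2 + lam) := by
      rw [hη]; field_simp; ring
    rw [h5, div_mul_eq_mul_div, le_div_iff₀ hgl]
    linarith
  obtain ⟨q, hqd, hq1, hq⟩ := exists_polynomial_small η hη0 hη1 n
  have hbound := norm_inner_aeval_le hSsa Kᗮ (fun z hz => hLperp' _ (hLperp z hz)) η
    (fun z _ => by rw [hSi]; positivity) (fun z hz => by rw [hSi]; exact hdl z hz) hη1.le q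
    (2 * Real.exp (-(n * √η))) (by positivity) hq x y hyK
  -- `S = star L * L` consists of four layers: odd, even, even, odd. Hence four blocks per power.
  have hcone : ∀ m : ℕ, ∃ W ∈ coneMonoid h s b (β + 4 * m), (S ^ m) y = W y := by
    intro m
    induction m with
    | zero => exact ⟨1, Submonoid.one_mem _, by simp⟩
    | succ m ih =>
      obtain ⟨W, hW, e⟩ := ih
      have h0 : β ≤ β + 4 * (m : ℤ) := by omega
      obtain ⟨W1, hW1, e1⟩ := exists_coneMonoid_layer hcomm h0 hy 1 l1 hm1 hW
      obtain ⟨W2, hW2, e2⟩ := exists_coneMonoid_layer hcomm (by omega) hy 0 l0 hm0 hW1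
      obtain ⟨W3, hW3, e3⟩ := exists_coneMonoid_layer hcomm (by omega) hy 0 l0.reverse
        (by simpa using hm0) hW2
      obtain ⟨W4, hW4, e4⟩ := exists_coneMonoid_layer hcomm (by omega) hy 1 l1.reverse
        (by simpa using hm1) hW3
      refine ⟨W4, ?_, ?_⟩
      · convert hW4 using 2
        push_cast
        ring
      · rw [pow_succ', mul_apply_eq_comp, e, hS, mul_apply_eq_comp, hStar, hL, complProd_append,
          List.reverse_append, complProd_append]
        simp only [mul_apply_eq_comp]
        rw [e1, e2, e3, e4]
  have hpow : ∀ m ≤ n, inner ℂ x ((S ^ m) y) = inner ℂ x y := by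
    intro m hm
    obtain ⟨W, hW, e⟩ := hcone m
    rw [e]
    exact inner_coneMonoid_apply hp (fun i hi hb => hx i hi (by omega)) hW y
  -- All powers up to the degree of `q` have the same matrix element, so only the sum of the
  -- coefficients, `q(1) = 1`, matters.
  have hq' : inner ℂ x (aeval S q y) = inner ℂ x y := by
    rw [aeval_eq_sum_range' (Nat.lt_succ_of_le hqd)]
    simp only [sum_apply, smul_apply, inner_sum]
    rw [eval_eq_sum_range' (Nat.lt_succ_of_le hqd)] at hq1
    simp only [one_pow, mul_one] at hq1
    calc _ = ∑ m ∈ Finset.range n.succ, (q.coeff m : ℂ) * inner ℂ x y := by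
          refine Finset.sum_congr rfl fun m hm => ?_
          rw [← Complex.coe_smul, inner_smul_right, hpow m (by simpa [Nat.lt_succ_iff] using hm)]
      _ = _ := by
          rw [← Finset.sum_mul, ← Complex.ofReal_sum, hq1, Complex.ofReal_one, one_mul]
  rwa [hq'] at hbound

end

/-! ### The abstract recursive step for the gap -/

section

open InnerProductSpace

set_option linter.unusedSectionVars false

variable {E : Type*} [NormedAddCommGroup E] [InnerProductSpace ℂ E] [FiniteDimensional ℂ E]
  [CompleteSpace E]

/-- The common kernel of a finite family of operators. -/
def commonKer {I : Type*} (h : I → E →L[ℂ] E) (s : Finset I) : Submodule ℂ E :=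
  ⨅ i ∈ s, LinearMap.ker (h i : E →ₗ[ℂ] E)

lemma mem_commonKer {I : Type*} {h : I → E →L[ℂ] E} {s : Finset I} {x : E} :
    x ∈ commonKer h s ↔ ∀ i ∈ s, h i x = 0 := by
  simp [commonKer, Submodule.mem_iInf]

lemma commonKer_anti {I : Type*} (h : I → E →L[ℂ] E) {s t : Finset I} (hst : s ⊆ t) :
    commonKer h t ≤ commonKer h s := fun _ hx =>
  mem_commonKer.mpr fun i hi => mem_commonKer.mp hx i (hst hi)

/-- A gap on the orthogonal complement of the common kernel, for arbitrary vectors. -/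
lemma gap_mul_le_sum {I : Type*} {h : I → E →L[ℂ] E} {s : Finset I} {γ : ℝ}
    (hγ : ∀ x ∈ (commonKer h s)ᗮ, γ * ‖x‖ ^ 2 ≤ ∑ i ∈ s, ‖h i x‖ ^ 2) (x : E) :
    γ * (‖x‖ ^ 2 - ‖(commonKer h s).starProjection x‖ ^ 2) ≤ ∑ i ∈ s, ‖h i x‖ ^ 2 := by
  set P := (commonKer h s).starProjection
  have hP : IsStarProjection P := isStarProjection_starProjection
  have h1 := hγ ((1 - P) x) (by
    rw [sub_apply, one_apply_eq_self]
    exact (commonKer h s).sub_starProjection_mem_orthogonal x)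
  rw [norm_sq_one_sub_apply hP] at h1
  refine h1.trans_eq (Finset.sum_congr rfl fun i hi => ?_)
  have h2 : h i (P x) = 0 :=
    mem_commonKer.mp ((commonKer h s).starProjection_apply_mem x) i hi
  simp [h2]

/-- Two almost orthogonal families of vectors capture little more than one vector. -/
lemma norm_sq_add_norm_sq_le {a b x : E} {δ : ℝ} (hδ : 0 ≤ δ)
    (ha : (inner ℂ a x).re = ‖a‖ ^ 2) (hb : (inner ℂ b x).re = ‖b‖ ^ 2)
    (hab : ‖inner ℂ a b‖ ≤ δ * (‖a‖ * ‖b‖)) : ‖a‖ ^ 2 + ‖b‖ ^ 2 ≤ (1 + δ) * ‖x‖ ^ 2 := by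
  have h1 : ‖a‖ ^ 2 + ‖b‖ ^ 2 ≤ ‖a + b‖ * ‖x‖ := by
    rw [← ha, ← hb, ← Complex.add_re, ← inner_add_left]
    exact re_inner_le_norm (𝕜 := ℂ) _ _
  have h2 : ‖a + b‖ ^ 2 ≤ (1 + δ) * (‖a‖ ^ 2 + ‖b‖ ^ 2) := by
    rw [norm_add_sq (𝕜 := ℂ)]
    have h3 : RCLike.re (inner ℂ a b) ≤ δ * (‖a‖ * ‖b‖) := (RCLike.re_le_norm _).trans hab
    nlinarith [sq_nonneg (‖a‖ - ‖b‖)]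
  set t := ‖a‖ ^ 2 + ‖b‖ ^ 2
  have ht : 0 ≤ t := by positivity
  rcases ht.eq_or_lt with h0 | h0
  · rw [← h0]; positivity
  · have h3 : t ^ 2 ≤ (1 + δ) * t * ‖x‖ ^ 2 := by
      calc t ^ 2 ≤ (‖a + b‖ * ‖x‖) ^ 2 := by gcongr
        _ = ‖a + b‖ ^ 2 * ‖x‖ ^ 2 := by ring
        _ ≤ _ := by gcongr
    nlinarith

lemma re_inner_starProjection_eq (U : Submodule ℂ E) (x : E) :
    (inner ℂ (U.starProjection x) x).re = ‖U.starProjection x‖ ^ 2 := by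
  have hP : IsStarProjection U.starProjection := isStarProjection_starProjection
  rw [inner_selfAdjoint_apply hP.isSelfAdjoint, re_inner_starProjection_apply hP]

/-- The projection is self-adjoint and fixes `K` pointwise. Applied to the ground space of one part,
it keeps a vector orthogonal to the ground space of the whole, as the overlap bound demands. -/
lemma starProjection_mem_orthogonal_of_le {U K : Submodule ℂ E} (hK : K ≤ U) {x : E}
    (hx : x ∈ Kᗮ) : U.starProjection x ∈ Kᗮ := by
  have hP : IsStarProjection U.starProjection := isStarProjection_starProjection
  rw [Submodule.mem_orthogonal] at hx ⊢
  intro u hu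
  rw [← inner_selfAdjoint_apply hP.isSelfAdjoint, U.starProjection_eq_self_iff.mpr (hK hu)]
  exact hx u hu

open Classical in
/-- The recursive step: a gap for many pairs of subregions with disjoint overlaps gives a gap for
the whole region. -/
theorem gap_step {I : Type*} {h : I → E →L[ℂ] E} (s : Finset I) (N : ℕ) (A B : ℕ → Finset I)
    (hA : ∀ i < N, A i ⊆ s) (hB : ∀ i < N, B i ⊆ s)
    (hdisj : ∀ i < N, ∀ j < N, i ≠ j → Disjoint (A i ∩ B i) (A j ∩ B j))
    {γ δ : ℝ} (hγ : 0 ≤ γ) (hδ : 0 ≤ δ)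
    (hgA : ∀ i < N, ∀ x ∈ (commonKer h (A i))ᗮ, γ * ‖x‖ ^ 2 ≤ ∑ j ∈ A i, ‖h j x‖ ^ 2)
    (hgB : ∀ i < N, ∀ x ∈ (commonKer h (B i))ᗮ, γ * ‖x‖ ^ 2 ≤ ∑ j ∈ B i, ‖h j x‖ ^ 2)
    (hAB : ∀ i < N, ∀ x ∈ commonKer h (A i), ∀ y ∈ commonKer h (B i), y ∈ (commonKer h s)ᗮ →
      ‖inner ℂ x y‖ ≤ δ * (‖x‖ * ‖y‖))
    {x : E} (hx : x ∈ (commonKer h s)ᗮ) :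
    N * (γ * (1 - δ)) * ‖x‖ ^ 2 ≤ (N + 1) * ∑ j ∈ s, ‖h j x‖ ^ 2 := by
  -- One cut: the two gap inequalities add up to `γ (2 - (1 + δ)) ‖x‖²`, and only the terms in the
  -- overlap are counted twice.
  have h1 : ∀ i ∈ Finset.range N, γ * (1 - δ) * ‖x‖ ^ 2 ≤
      ∑ j ∈ s, ‖h j x‖ ^ 2 + ∑ j ∈ A i ∩ B i, ‖h j x‖ ^ 2 := by
    intro i hi
    rw [Finset.mem_range] at hi
    have h2 := gap_mul_le_sum (hgA i hi) x
    have h3 := gap_mul_le_sum (hgB i hi) x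
    have h4 := norm_sq_add_norm_sq_le hδ (re_inner_starProjection_eq (commonKer h (A i)) x)
      (re_inner_starProjection_eq (commonKer h (B i)) x)
      (hAB i hi _ (Submodule.starProjection_apply_mem _ x) _
        (Submodule.starProjection_apply_mem _ x)
        (starProjection_mem_orthogonal_of_le (commonKer_anti h (hB i hi)) hx))
    have h5 := Finset.sum_union_inter (s₁ := A i) (s₂ := B i) (f := fun j => ‖h j x‖ ^ 2)
    have h6 : ∑ j ∈ A i ∪ B i, ‖h j x‖ ^ 2 ≤ ∑ j ∈ s, ‖h j x‖ ^ 2 :=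
      Finset.sum_le_sum_of_subset_of_nonneg (Finset.union_subset (hA i hi) (hB i hi))
        fun _ _ _ => sq_nonneg _
    have h7 := mul_le_mul_of_nonneg_left h4 hγ
    linarith
  have h2 : ∑ i ∈ Finset.range N, ∑ j ∈ A i ∩ B i, ‖h j x‖ ^ 2 ≤ ∑ j ∈ s, ‖h j x‖ ^ 2 := by
    rw [← Finset.sum_biUnion]
    · refine Finset.sum_le_sum_of_subset_of_nonneg ?_ fun _ _ _ => sq_nonneg _
      refine Finset.biUnion_subset.mpr fun i hi => ?_
      exact Finset.inter_subset_left.trans (hA i (Finset.mem_range.mp hi))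
    · intro i hi j hj hij
      exact hdisj i (by simpa using hi) j (by simpa using hj) hij
  have h3 := Finset.sum_le_sum h1
  rw [Finset.sum_add_distrib, Finset.sum_const, Finset.sum_const, Finset.card_range,
    nsmul_eq_mul, nsmul_eq_mul] at h3
  linarith

end

/-! ### Gaps and quadratic forms of Hermitian matrices -/

section

open InnerProductSpace

section Gap

variable {n : Type*} [Fintype n] [DecidableEq n]

/-- A matrix as a continuous operator on Euclidean space. -/
abbrev toCLM (A : Matrix n n ℂ) : EuclideanSpace ℂ n →L[ℂ] EuclideanSpace ℂ n :=
  Matrix.toEuclideanCLM (𝕜 := ℂ) A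

lemma isSelfAdjoint_toCLM {A : Matrix n n ℂ} (hA : A.IsHermitian) : IsSelfAdjoint (toCLM A) := by
  rw [isSelfAdjoint_iff, toCLM, ← map_star, Matrix.star_eq_conjTranspose, hA.eq]

lemma toCLM_eigenvectorBasis {A : Matrix n n ℂ} (hA : A.IsHermitian) (i : n) :
    toCLM A (hA.eigenvectorBasis i) = (hA.eigenvalues i : ℂ) • hA.eigenvectorBasis i := by
  have h := hA.mulVec_eigenvectorBasis i
  ext k
  have := congrFun h k
  simpa [Matrix.ofLp_toEuclideanCLM] using this

lemma posSemidef_iff_toCLM {A : Matrix n n ℂ} :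
    A.PosSemidef ↔ A.IsHermitian ∧ ∀ x, 0 ≤ (inner ℂ x (toCLM A x)).re := by
  constructor
  · intro h
    refine ⟨h.isHermitian, fun x => ?_⟩
    have h1 := h.re_dotProduct_nonneg x.ofLp
    rw [EuclideanSpace.inner_eq_star_dotProduct, Matrix.ofLp_toEuclideanCLM, dotProduct_comm]
    exact h1
  · rintro ⟨h, h1⟩
    rw [← Matrix.isPositive_toEuclideanLin_iff]
    refine ⟨Matrix.isSymmetric_toEuclideanLin_iff.mpr h, fun x => ?_⟩
    rw [← inner_re_symm]
    exact h1 x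

/-- A lower bound on the quadratic form off the kernel bounds the gap from below. -/
lemma le_gapOp {A : Matrix n n ℂ} (hA : A.IsHermitian) {γ : ℝ}
    (h : ∀ x ∈ (LinearMap.ker (toCLM A : EuclideanSpace ℂ n →ₗ[ℂ] EuclideanSpace ℂ n))ᗮ,
      γ * ‖x‖ ^ 2 ≤ (inner ℂ x (toCLM A x)).re) : (γ : EReal) ≤ gapOp A := by
  refine le_iInf₂ fun r hr => EReal.coe_le_coe_iff.mpr ?_
  obtain ⟨hr, hr0⟩ := hr
  rw [hA.spectrum_real_eq_range_eigenvalues] at hr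
  obtain ⟨i, rfl⟩ := hr
  set v := hA.eigenvectorBasis i with hv
  have h1 : toCLM A v = (hA.eigenvalues i : ℂ) • v := toCLM_eigenvectorBasis hA i
  have hr0' : (hA.eigenvalues i : ℂ) ≠ 0 := by simpa using hr0
  have h2 := h v (by
    rw [Submodule.mem_orthogonal]
    intro u hu
    have h3 : v = (hA.eigenvalues i : ℂ)⁻¹ • toCLM A v := by
      rw [h1, smul_smul, inv_mul_cancel₀ hr0', one_smul]
    have h4 : toCLM A u = 0 := hu
    rw [h3, inner_smul_right, ← inner_selfAdjoint_apply (isSelfAdjoint_toCLM hA), h4,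
      inner_zero_left, mul_zero])
  have h5 : ‖v‖ = 1 := hA.eigenvectorBasis.norm_eq_one i
  have h6 : (inner ℂ v v) = (1 : ℂ) := by
    rw [inner_self_eq_norm_sq_to_K, h5]; simp
  rw [h1, inner_smul_right, h5, h6] at h2
  simpa using h2

lemma inner_toCLM_eq_sum {A : Matrix n n ℂ} (hA : A.IsHermitian) (x : EuclideanSpace ℂ n) :
    (inner ℂ x (toCLM A x)).re =
      ∑ i, hA.eigenvalues i * ‖inner ℂ (hA.eigenvectorBasis i) x‖ ^ 2 := by
  rw [← hA.eigenvectorBasis.sum_inner_mul_inner x (toCLM A x), Complex.re_sum]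
  refine Finset.sum_congr rfl fun i _ => ?_
  rw [← inner_selfAdjoint_apply (isSelfAdjoint_toCLM hA), toCLM_eigenvectorBasis hA,
    inner_smul_left, Complex.conj_ofReal, ← inner_conj_symm x, mul_left_comm,
    Complex.re_ofReal_mul, RCLike.conj_mul]
  norm_cast

/-- A gap bounds the quadratic form of a positive semidefinite matrix off its kernel. -/
lemma gapOp_mul_le {A : Matrix n n ℂ} (hA : A.PosSemidef) {γ : ℝ} (hγ : (γ : EReal) ≤ gapOp A)
    {x : EuclideanSpace ℂ n}
    (hx : x ∈ (LinearMap.ker (toCLM A : EuclideanSpace ℂ n →ₗ[ℂ] EuclideanSpace ℂ n))ᗮ) :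
    γ * ‖x‖ ^ 2 ≤ (inner ℂ x (toCLM A x)).re := by
  have hH := hA.isHermitian
  rw [inner_toCLM_eq_sum hH, ← hH.eigenvectorBasis.sum_sq_norm_inner_right x, Finset.mul_sum]
  refine Finset.sum_le_sum fun i _ => ?_
  by_cases h0 : hH.eigenvalues i = 0
  · have h1 : inner ℂ (hH.eigenvectorBasis i) x = 0 := by
      rw [Submodule.mem_orthogonal] at hx
      refine hx _ ?_
      change toCLM A _ = 0
      rw [toCLM_eigenvectorBasis, h0]
      simp
    simp [h1]
  · gcongr
    rw [← EReal.coe_le_coe_iff]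
    refine hγ.trans (iInf₂_le _ ⟨?_, h0⟩)
    rw [hH.spectrum_real_eq_range_eigenvalues]
    exact ⟨i, rfl⟩

/-- An algebra homomorphism can only shrink the spectrum. For `A ↦ A ⊗ Id` this carries the gap of a
subregion over to the Hilbert space of a larger one. -/
lemma gapOp_map_le {m : Type*} [Fintype m] [DecidableEq m] {A : Matrix n n ℂ}
    (f : Matrix n n ℂ →ₐ[ℝ] Matrix m m ℂ) : gapOp A ≤ gapOp (f A) :=
  biInf_mono fun _ hr => ⟨AlgHom.spectrum_apply_subset f A hr.1, hr.2⟩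

lemma ker_toCLM_eq {A : Matrix n n ℂ} (hA : A.PosSemidef) {x : EuclideanSpace ℂ n} :
    toCLM A x = 0 ↔ (inner ℂ x (toCLM A x)).re = 0 := by
  refine ⟨fun h => by simp [h], fun h => ?_⟩
  have hH := hA.isHermitian
  rw [inner_toCLM_eq_sum hH, Finset.sum_eq_zero_iff_of_nonneg
    fun i _ => mul_nonneg (hA.eigenvalues_nonneg i) (sq_nonneg _)] at h
  refine InnerProductSpace.ext_inner_left_basis hH.eigenvectorBasis.toBasis fun i => ?_
  rw [OrthonormalBasis.coe_toBasis, inner_zero_right,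
    ← inner_selfAdjoint_apply (isSelfAdjoint_toCLM hH), toCLM_eigenvectorBasis, inner_smul_left]
  have := h i (Finset.mem_univ i)
  simpa using this

/-- Comparison of the gaps of two positive semidefinite matrices with comparable quadratic forms. -/
lemma mul_le_gapOp_of_comparable {A B : Matrix n n ℂ} (hA : A.PosSemidef) (hB : B.PosSemidef)
    {c c' γ : ℝ} (hc : 0 ≤ c)
    (h1 : ∀ x, c * (inner ℂ x (toCLM B x)).re ≤ (inner ℂ x (toCLM A x)).re)
    (h2 : ∀ x, (inner ℂ x (toCLM A x)).re ≤ c' * (inner ℂ x (toCLM B x)).re)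
    (hγ : (γ : EReal) ≤ gapOp B) : ((c * γ : ℝ) : EReal) ≤ gapOp A := by
  refine le_gapOp hA.isHermitian fun x hx => ?_
  have h3 : γ * ‖x‖ ^ 2 ≤ (inner ℂ x (toCLM B x)).re := by
    -- The upper comparison serves only to show that `ker B ≤ ker A`, which is why `c'` is absent
    -- from the conclusion.
    refine gapOp_mul_le hB hγ (Submodule.orthogonal_le ?_ hx)
    intro u hu
    have h4 : toCLM B u = 0 := hu
    change toCLM A u = 0
    rw [ker_toCLM_eq hA]
    refine le_antisymm ?_ ((posSemidef_iff_toCLM.mp hA).2 u)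
    simpa [h4] using h2 u
  calc c * γ * ‖x‖ ^ 2 = c * (γ * ‖x‖ ^ 2) := by ring
    _ ≤ c * (inner ℂ x (toCLM B x)).re := by gcongr
    _ ≤ _ := h1 x

lemma toCLM_rangeProj (A : Matrix n n ℂ) :
    toCLM (rangeProj A) = (LinearMap.range (Matrix.toEuclideanLin A)).starProjection := by
  refine ContinuousLinearMap.coe_injective ?_
  rw [toCLM, Matrix.coe_toEuclideanCLM_eq_toEuclideanLin, rangeProj, LinearEquiv.apply_symm_apply]

lemma isStarProjection_rangeProj (A : Matrix n n ℂ) : IsStarProjection (rangeProj A) := by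
  have h : IsStarProjection (toCLM (rangeProj A)) := by
    rw [toCLM_rangeProj]
    exact isStarProjection_starProjection
  have hinj : Function.Injective (toCLM (n := n)) := EquivLike.injective _
  refine ⟨hinj ?_, hinj ?_⟩
  · rw [toCLM, map_mul]
    exact h.isIdempotentElem
  · rw [toCLM, map_star]
    exact h.isSelfAdjoint

lemma rangeProj_zero : rangeProj (0 : Matrix n n ℂ) = 0 := by
  have h : toCLM (rangeProj (0 : Matrix n n ℂ)) = 0 := by
    rw [toCLM_rangeProj]
    simp
  simpa using h

omit [DecidableEq n] in
lemma posSemidef_of_isStarProjection {P : Matrix n n ℂ} (hP : IsStarProjection P) :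
    P.PosSemidef := by
  have h : P = P.conjTranspose * P := by
    rw [← Matrix.star_eq_conjTranspose, hP.isSelfAdjoint.star_eq, hP.isIdempotentElem.eq]
  rw [h]
  exact Matrix.posSemidef_conjTranspose_mul_self P

/-- A positive semidefinite matrix is comparable with the projection onto its range. -/
lemma posSemidef_sub_rangeProj {A : Matrix n n ℂ} (hA : A.PosSemidef) {c c' : ℝ}
    (hc : (c : EReal) ≤ gapOp A) (hc' : ‖toCLM A‖ ≤ c') :
    (A - (c : ℂ) • rangeProj A).PosSemidef ∧ ((c' : ℂ) • rangeProj A - A).PosSemidef := by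
  set U := LinearMap.range (Matrix.toEuclideanLin A) with hU
  have hsa := isSelfAdjoint_toCLM hA.isHermitian
  have hP := isStarProjection_rangeProj A
  have hPH : (rangeProj A).IsHermitian := hP.isSelfAdjoint
  have hsm : ∀ r : ℝ, ((r : ℂ) • rangeProj A).IsHermitian := fun r => by
    rw [Matrix.IsHermitian, Matrix.conjTranspose_smul, hPH.eq]
    simp
  have hker : Uᗮ = LinearMap.ker (toCLM A : EuclideanSpace ℂ n →ₗ[ℂ] EuclideanSpace ℂ n) :=
    (Matrix.isSymmetric_toEuclideanLin_iff.mpr hA.isHermitian).orthogonal_range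
  -- The kernel is the orthogonal complement of the range, so the form sees only the range
  -- component. There the gap and the norm bound it from both sides.
  have hkey : ∀ x, (inner ℂ x (toCLM A x)).re =
      (inner ℂ (U.starProjection x) (toCLM A (U.starProjection x))).re := by
    intro x
    have h1 : toCLM A (x - U.starProjection x) = 0 := by
      have := U.sub_starProjection_mem_orthogonal x
      rw [hker] at this
      exact this
    rw [map_sub, sub_eq_zero] at h1
    rw [h1, ← inner_selfAdjoint_apply hsa, ← inner_selfAdjoint_apply hsa, h1]
  have hPx : ∀ x, (inner ℂ x (toCLM (rangeProj A) x)).re = ‖U.starProjection x‖ ^ 2 := by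
    intro x
    rw [toCLM_rangeProj, re_inner_starProjection_apply isStarProjection_starProjection]
  have hsi : ∀ (r : ℝ) x, (inner ℂ x (toCLM ((r : ℂ) • rangeProj A) x)).re =
      r * ‖U.starProjection x‖ ^ 2 := by
    intro r x
    rw [toCLM, map_smul, smul_apply, inner_smul_right, Complex.re_ofReal_mul, hPx]
  constructor
  · rw [posSemidef_iff_toCLM]
    refine ⟨hA.isHermitian.sub (hsm c), fun x => ?_⟩
    rw [toCLM, map_sub, sub_apply, inner_sub_right, Complex.sub_re, hsi, hkey]
    have h2 := gapOp_mul_le hA hc (x := U.starProjection x) (by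
      rw [← hker]
      exact U.le_orthogonal_orthogonal (U.starProjection_apply_mem x))
    linarith
  · rw [posSemidef_iff_toCLM]
    refine ⟨(hsm c').sub hA.isHermitian, fun x => ?_⟩
    rw [toCLM, map_sub, sub_apply, inner_sub_right, Complex.sub_re, hsi, hkey]
    have h2 : (inner ℂ (U.starProjection x) (toCLM A (U.starProjection x))).re ≤
        ‖U.starProjection x‖ * (c' * ‖U.starProjection x‖) :=
      (re_inner_le_norm (𝕜 := ℂ) _ _).trans (by
        gcongr
        exact (toCLM A).le_of_opNorm_le hc' _)
    linarith

end Gap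

end

/-! ### Inclusion of local algebras -/

section

open InnerProductSpace

section Extend

variable {V : Type*} [DecidableEq V] {d : ℕ}

/-- Configurations on `Y` split into their restrictions to `X` and to the complement of `X`. -/
def configEquiv (d : ℕ) {X Y : Finset V} (h : X ⊆ Y) :
    Config d Y ≃ Config d X × ({i : Y // (i : V) ∉ X} → Fin d) where
  toFun σ := (fun i => σ ⟨i, h i.2⟩, fun i => σ i)
  invFun p i := if hi : (i : V) ∈ X then p.1 ⟨i, hi⟩ else p.2 ⟨i, hi⟩
  left_inv σ := by
    ext i
    by_cases hi : (i : V) ∈ X <;> simp [hi]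
  right_inv p := by
    ext i
    · simp
    · simp [i.2]

open scoped Kronecker in
lemma extend_eq_kronecker {X Y : Finset V} (h : X ⊆ Y) (A : LocalOp d X) :
    extend h A = (A ⊗ₖ (1 : Matrix ({i : Y // (i : V) ∉ X} → Fin d)
      ({i : Y // (i : V) ∉ X} → Fin d) ℂ)).submatrix (configEquiv d h) (configEquiv d h) := by
  ext σ τ
  have : (∀ i : Y, (i : V) ∉ X → σ i = τ i) ↔
      (configEquiv d h σ).2 = (configEquiv d h τ).2 := by
    simp [configEquiv, funext_iff]
  simp only [extend, Matrix.submatrix_apply, Matrix.kroneckerMap_apply, Matrix.one_apply, this,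
    mul_ite, mul_one, mul_zero]
  rfl

lemma extend_add {X Y : Finset V} (h : X ⊆ Y) (A B : LocalOp d X) :
    extend h (A + B) = extend h A + extend h B := by
  simp only [extend_eq_kronecker, Matrix.add_kronecker, Matrix.submatrix_add, Pi.add_apply]

lemma extend_smul {X Y : Finset V} (h : X ⊆ Y) (c : ℂ) (A : LocalOp d X) :
    extend h (c • A) = c • extend h A := by
  simp only [extend_eq_kronecker, Matrix.smul_kronecker, Matrix.submatrix_smul, Pi.smul_apply]

lemma extend_mul {X Y : Finset V} (h : X ⊆ Y) (A B : LocalOp d X) :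
    extend h (A * B) = extend h A * extend h B := by
  simp only [extend_eq_kronecker, Matrix.submatrix_mul_equiv, ← Matrix.mul_kronecker_mul, mul_one]

lemma extend_one {X Y : Finset V} (h : X ⊆ Y) : extend h (1 : LocalOp d X) = 1 := by
  rw [extend_eq_kronecker, Matrix.one_kronecker_one, Matrix.submatrix_one_equiv]

lemma extend_conjTranspose {X Y : Finset V} (h : X ⊆ Y) (A : LocalOp d X) :
    extend h A.conjTranspose = (extend h A).conjTranspose := by
  rw [extend_eq_kronecker, extend_eq_kronecker, Matrix.conjTranspose_submatrix,
    Matrix.conjTranspose_kronecker, Matrix.conjTranspose_one]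

lemma extend_posSemidef {X Y : Finset V} (h : X ⊆ Y) {A : LocalOp d X} (hA : A.PosSemidef) :
    (extend h A).PosSemidef := by
  rw [extend_eq_kronecker]
  exact (hA.kronecker Matrix.PosSemidef.one).submatrix _

/-- The inclusion of local algebras as an algebra homomorphism. -/
def extendHom {X Y : Finset V} (h : X ⊆ Y) : LocalOp d X →ₐ[ℂ] LocalOp d Y :=
  AlgHom.ofLinearMap ⟨⟨extend h, extend_add h⟩, extend_smul h⟩ (extend_one h) (extend_mul h)

lemma extendHom_apply {X Y : Finset V} (h : X ⊆ Y) (A : LocalOp d X) :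
    extendHom h A = extend h A := rfl

lemma extend_extend {X Y Z : Finset V} (h : X ⊆ Y) (h' : Y ⊆ Z) (A : LocalOp d X) :
    extend h' (extend h A) = extend (h.trans h') A := by
  ext σ τ
  simp only [extend]
  rw [← ite_and]
  refine if_congr ⟨?_, ?_⟩ rfl rfl
  · rintro ⟨h1, h2⟩ i hi
    by_cases hiY : (i : V) ∈ Y
    · exact h2 ⟨i, hiY⟩ hi
    · exact h1 i hiY
  · intro h1
    exact ⟨fun i hi => h1 i fun hx => hi (h hx), fun i hi => h1 ⟨i, h' i.2⟩ hi⟩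

/-- Only one intermediate configuration contributes: `τ` on `X` and `σ` elsewhere. The resulting
formula is symmetric in the two factors, which yields commutation for disjoint supports. -/
lemma extend_mul_extend_apply {X X' Y : Finset V} (h : X ⊆ Y) (h' : X' ⊆ Y)
    (hd : Disjoint X X') (A : LocalOp d X) (B : LocalOp d X') (σ τ : Config d Y) :
    (extend h A * extend h' B) σ τ =
      if ∀ i : Y, (i : V) ∉ X → (i : V) ∉ X' → σ i = τ i then
        A (fun i => σ ⟨i, h i.2⟩) (fun i => τ ⟨i, h i.2⟩) *
          B (fun i => σ ⟨i, h' i.2⟩) (fun i => τ ⟨i, h' i.2⟩)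
      else 0 := by
  set ρ : Config d Y := fun i => if (i : V) ∈ X then τ i else σ i with hρ
  have hX' : ∀ i : X', (i : V) ∉ X := fun i hi => Finset.disjoint_left.mp hd hi i.2
  rw [Matrix.mul_apply, Finset.sum_eq_single ρ]
  · have h1 : ∀ i : Y, (i : V) ∉ X → σ i = ρ i := fun i hi => by simp [hρ, hi]
    have h2 : (∀ i : Y, (i : V) ∉ X' → ρ i = τ i) ↔
        ∀ i : Y, (i : V) ∉ X → (i : V) ∉ X' → σ i = τ i := by
      refine forall_congr' fun i => ?_
      by_cases hi : (i : V) ∈ X <;> simp [hρ, hi]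
    have h3 : (fun i : X => ρ ⟨i, h i.2⟩) = fun i : X => τ ⟨i, h i.2⟩ := by
      ext i; simp [hρ]
    have h4 : (fun i : X' => ρ ⟨i, h' i.2⟩) = fun i : X' => σ ⟨i, h' i.2⟩ := by
      ext i; simp [hρ, hX' i]
    simp only [extend]
    rw [if_pos h1, h3, h4]
    simp only [h2, mul_ite, mul_zero]
  · intro θ _ hθ
    by_contra hne
    apply hθ
    have hA : extend h A σ θ ≠ 0 := left_ne_zero_of_mul hne
    have hB : extend h' B θ τ ≠ 0 := right_ne_zero_of_mul hne
    simp only [extend, ne_eq, ite_eq_right_iff, Classical.not_imp] at hA hB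
    ext i
    by_cases hi : (i : V) ∈ X
    · have := hB.1 i (Finset.disjoint_left.mp hd hi)
      simp [hρ, hi, this]
    · simp [hρ, hi, hA.1 i hi]
  · simp

lemma commute_extend {X X' Y : Finset V} (h : X ⊆ Y) (h' : X' ⊆ Y) (hd : Disjoint X X')
    (A : LocalOp d X) (B : LocalOp d X') : Commute (extend h A) (extend h' B) := by
  ext σ τ
  rw [extend_mul_extend_apply h h' hd, extend_mul_extend_apply h' h hd.symm]
  refine if_congr (forall_congr' fun i => ?_) (mul_comm _ _) rfl
  exact ⟨fun H h1 h2 => H h2 h1, fun H h1 h2 => H h2 h1⟩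

/-- A local operator acting on the Hilbert space of the region `Y`, or zero if it does not fit. -/
def opOn (Y X : Finset V) (A : LocalOp d X) :
    EuclideanSpace ℂ (Config d Y) →L[ℂ] EuclideanSpace ℂ (Config d Y) :=
  if h : X ⊆ Y then toCLM (extend h A) else 0

lemma opOn_of_subset {X Y : Finset V} (h : X ⊆ Y) (A : LocalOp d X) :
    opOn Y X A = toCLM (extend h A) := dif_pos h

lemma extend_zero {X Y : Finset V} (h : X ⊆ Y) : extend h (0 : LocalOp d X) = 0 :=
  map_zero (extendHom h)

lemma opOn_zero (X Y : Finset V) : opOn Y X (0 : LocalOp d X) = 0 := by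
  by_cases h : X ⊆ Y
  · rw [opOn_of_subset h, extend_zero, toCLM, map_zero]
  · simp [opOn, h]

lemma isStarProjection_opOn {X Y : Finset V} {A : LocalOp d X} (hA : IsStarProjection A) :
    IsStarProjection (opOn Y X A) := by
  by_cases h : X ⊆ Y
  · rw [opOn_of_subset h]
    constructor
    · rw [IsIdempotentElem, toCLM, ← map_mul, ← extend_mul, hA.isIdempotentElem.eq]
    · refine isSelfAdjoint_toCLM ?_
      rw [Matrix.IsHermitian, ← extend_conjTranspose, ← Matrix.star_eq_conjTranspose,
        hA.isSelfAdjoint.star_eq]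
  · simp [opOn, h, IsStarProjection.zero]

lemma commute_opOn {X X' Y : Finset V} (hd : Disjoint X X') (A : LocalOp d X)
    (B : LocalOp d X') : Commute (opOn Y X A) (opOn Y X' B) := by
  by_cases h : X ⊆ Y
  · by_cases h' : X' ⊆ Y
    · rw [opOn_of_subset h, opOn_of_subset h']
      exact (commute_extend h h' hd A B).map (Matrix.toEuclideanCLM (𝕜 := ℂ))
    · simp [opOn, h']
  · simp [opOn, h]

lemma toCLM_extend_hamiltonian (Ψ : Interaction V d) {A Y : Finset V} (h : A ⊆ Y) :
    toCLM (extend h (hamiltonian Ψ A)) = ∑ X ∈ A.powerset, opOn Y X (Ψ X) := by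
  rw [← extendHom_apply, hamiltonian, map_sum, toCLM, map_sum,
    ← Finset.sum_attach A.powerset (fun X => opOn Y X (Ψ X))]
  refine Finset.sum_congr rfl fun X _ => ?_
  rw [extendHom_apply, extend_extend, opOn_of_subset]

lemma extend_self {Y : Finset V} (A : LocalOp d Y) : extend subset_rfl A = A := by
  ext σ τ
  simp [extend]

lemma toCLM_hamiltonian (Ψ : Interaction V d) (Y : Finset V) :
    toCLM (hamiltonian Ψ Y) = ∑ X ∈ Y.powerset, opOn Y X (Ψ X) := by
  rw [← toCLM_extend_hamiltonian Ψ subset_rfl, extend_self]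

lemma posSemidef_hamiltonian {Ψ : Interaction V d} (hΨ : ∀ X, (Ψ X).PosSemidef) (Y : Finset V) :
    (hamiltonian Ψ Y).PosSemidef :=
  Matrix.posSemidef_sum _ fun X _ => extend_posSemidef _ (hΨ X.1)

end Extend

end

/-! ### Hamiltonians as sums of projections, and comparison of interactions -/

section

open InnerProductSpace

section Bridge

variable {V : Type*} [DecidableEq V] {d : ℕ}

open Classical in
/-- The subsets of a region that carry a nonzero interaction term. -/
def activeSets (Ψ : Interaction V d) (A : Finset V) : Finset (Finset V) :=
  A.powerset.filter fun X => Ψ X ≠ 0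

lemma mem_activeSets {Ψ : Interaction V d} {A X : Finset V} :
    X ∈ activeSets Ψ A ↔ X ⊆ A ∧ Ψ X ≠ 0 := by
  simp [activeSets]

lemma activeSets_mono (Ψ : Interaction V d) {A Y : Finset V} (h : A ⊆ Y) :
    activeSets Ψ A ⊆ activeSets Ψ Y := fun X hX => by
  rw [mem_activeSets] at hX ⊢
  exact ⟨hX.1.trans h, hX.2⟩

/-- The interaction terms as operators on the Hilbert space of the region `Y`. -/
abbrev termOn (Ψ : Interaction V d) (Y X : Finset V) :
    EuclideanSpace ℂ (Config d Y) →L[ℂ] EuclideanSpace ℂ (Config d Y) :=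
  opOn Y X (Ψ X)

lemma re_inner_extend_hamiltonian {Ψ : Interaction V d} (hΨ : ∀ X, IsStarProjection (Ψ X))
    {A Y : Finset V} (h : A ⊆ Y) (x : EuclideanSpace ℂ (Config d Y)) :
    (inner ℂ x (toCLM (extend h (hamiltonian Ψ A)) x)).re =
      ∑ X ∈ activeSets Ψ A, ‖termOn Ψ Y X x‖ ^ 2 := by
  rw [toCLM_extend_hamiltonian, sum_apply, inner_sum, Complex.re_sum, activeSets,
    Finset.sum_filter]
  refine Finset.sum_congr rfl fun X _ => ?_
  split_ifs with h0
  · exact re_inner_starProjection_apply (isStarProjection_opOn (hΨ X)) x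
  · rw [not_not.mp h0, opOn_zero]
    simp

/-- A sum of nonnegative energies vanishes only if each of them does. -/
lemma ker_extend_hamiltonian {Ψ : Interaction V d} (hΨ : ∀ X, IsStarProjection (Ψ X))
    {A Y : Finset V} (h : A ⊆ Y) :
    LinearMap.ker (toCLM (extend h (hamiltonian Ψ A)) :
      EuclideanSpace ℂ (Config d Y) →ₗ[ℂ] EuclideanSpace ℂ (Config d Y)) =
      commonKer (termOn Ψ Y) (activeSets Ψ A) := by
  ext x
  have h1 : (extend h (hamiltonian Ψ A)).PosSemidef :=
    extend_posSemidef h (posSemidef_hamiltonian (fun X => posSemidef_of_isStarProjection (hΨ X)) A)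
  change toCLM (extend h (hamiltonian Ψ A)) x = 0 ↔ _
  rw [ker_toCLM_eq h1, re_inner_extend_hamiltonian hΨ, mem_commonKer,
    Finset.sum_eq_zero_iff_of_nonneg fun _ _ => sq_nonneg _]
  simp

lemma gap_le_sum_activeSets {Ψ : Interaction V d} (hΨ : ∀ X, IsStarProjection (Ψ X))
    {A Y : Finset V} (h : A ⊆ Y) {γ : ℝ} (hγ : (γ : EReal) ≤ gapOp (hamiltonian Ψ A))
    {x : EuclideanSpace ℂ (Config d Y)}
    (hx : x ∈ (commonKer (termOn Ψ Y) (activeSets Ψ A))ᗮ) :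
    γ * ‖x‖ ^ 2 ≤ ∑ X ∈ activeSets Ψ A, ‖termOn Ψ Y X x‖ ^ 2 := by
  rw [← re_inner_extend_hamiltonian hΨ h]
  rw [← ker_extend_hamiltonian hΨ h] at hx
  refine gapOp_mul_le (extend_posSemidef h
    (posSemidef_hamiltonian (fun X => posSemidef_of_isStarProjection (hΨ X)) A)) ?_ hx
  exact hγ.trans (gapOp_map_le ((extendHom h).restrictScalars ℝ))

lemma le_gapOp_hamiltonian {Ψ : Interaction V d} (hΨ : ∀ X, IsStarProjection (Ψ X))
    {Y : Finset V} {γ : ℝ}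
    (h : ∀ x ∈ (commonKer (termOn Ψ Y) (activeSets Ψ Y))ᗮ,
      γ * ‖x‖ ^ 2 ≤ ∑ X ∈ activeSets Ψ Y, ‖termOn Ψ Y X x‖ ^ 2) :
    (γ : EReal) ≤ gapOp (hamiltonian Ψ Y) := by
  have hH := posSemidef_hamiltonian (fun X => posSemidef_of_isStarProjection (hΨ X)) Y
  refine le_gapOp hH.isHermitian fun x hx => ?_
  rw [← extend_self (hamiltonian Ψ Y), ker_extend_hamiltonian hΨ] at hx
  rw [← extend_self (hamiltonian Ψ Y), re_inner_extend_hamiltonian hΨ]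
  exact h x hx

lemma re_inner_opOn_nonneg {X Y : Finset V} {A : LocalOp d X} (hA : A.PosSemidef)
    (x : EuclideanSpace ℂ (Config d Y)) : 0 ≤ (inner ℂ x (opOn Y X A x)).re := by
  by_cases h : X ⊆ Y
  · rw [opOn_of_subset h]
    exact (posSemidef_iff_toCLM.mp (extend_posSemidef h hA)).2 x
  · simp [opOn, h]

lemma opOn_sub {X Y : Finset V} (A B : LocalOp d X) :
    opOn Y X (A - B) = opOn Y X A - opOn Y X B := by
  by_cases h : X ⊆ Y
  · simp only [opOn_of_subset h, ← extendHom_apply, map_sub]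
  · simp [opOn, h]

lemma opOn_smul {X Y : Finset V} (c : ℂ) (A : LocalOp d X) :
    opOn Y X (c • A) = c • opOn Y X A := by
  by_cases h : X ⊆ Y
  · simp only [opOn_of_subset h, ← extendHom_apply, map_smul]
  · simp only [opOn, h, dif_neg, not_false_eq_true]
    ext x
    simp

lemma re_inner_hamiltonian (Ψ : Interaction V d) (Y : Finset V)
    (x : EuclideanSpace ℂ (Config d Y)) :
    (inner ℂ x (toCLM (hamiltonian Ψ Y) x)).re =
      ∑ X ∈ Y.powerset, (inner ℂ x (opOn Y X (Ψ X) x)).re := by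
  rw [toCLM_hamiltonian, sum_apply, inner_sum, Complex.re_sum]

/-- Interactions that are comparable term by term have comparable gaps. -/
lemma mul_le_gapOp_hamiltonian {Φ Ψ : Interaction V d} (hΦ : ∀ X, (Φ X).PosSemidef)
    (hΨ : ∀ X, (Ψ X).PosSemidef) {c c' : ℝ} (hc : 0 ≤ c)
    (h1 : ∀ X, (Φ X - (c : ℂ) • Ψ X).PosSemidef) (h2 : ∀ X, ((c' : ℂ) • Ψ X - Φ X).PosSemidef)
    {γ : ℝ} {Y : Finset V} (hγ : (γ : EReal) ≤ gapOp (hamiltonian Ψ Y)) :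
    ((c * γ : ℝ) : EReal) ≤ gapOp (hamiltonian Φ Y) := by
  refine mul_le_gapOp_of_comparable (posSemidef_hamiltonian hΦ Y) (posSemidef_hamiltonian hΨ Y)
    (c' := c') hc (fun x => ?_) (fun x => ?_) hγ
  · rw [re_inner_hamiltonian, re_inner_hamiltonian, Finset.mul_sum]
    refine Finset.sum_le_sum fun X _ => ?_
    have h3 := re_inner_opOn_nonneg (h1 X) x
    rw [opOn_sub, opOn_smul, sub_apply, smul_apply, inner_sub_right, inner_smul_right,
      Complex.sub_re, Complex.re_ofReal_mul] at h3
    linarith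
  · rw [re_inner_hamiltonian, re_inner_hamiltonian, Finset.mul_sum]
    refine Finset.sum_le_sum fun X _ => ?_
    have h3 := re_inner_opOn_nonneg (h2 X) x
    rw [opOn_sub, opOn_smul, sub_apply, smul_apply, inner_sub_right, inner_smul_right,
      Complex.sub_re, Complex.re_ofReal_mul] at h3
    linarith

lemma mul_le_gapFamily {D : ℕ} {Φ Ψ : Interaction V d} (hΦ : ∀ X, (Φ X).PosSemidef)
    (hΨ : ∀ X, (Ψ X).PosSemidef) {c c' : ℝ} (hc : 0 ≤ c)
    (h1 : ∀ X, (Φ X - (c : ℂ) • Ψ X).PosSemidef) (h2 : ∀ X, ((c' : ℂ) • Ψ X - Φ X).PosSemidef)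
    (ι : V → EuclideanSpace ℝ (Fin D)) {k : ℕ} {γ : ℝ} (hγ : (γ : EReal) ≤ gapFamily Ψ ι k) :
    ((c * γ : ℝ) : EReal) ≤ gapFamily Φ ι k :=
  le_iInf₂ fun _ hΛ =>
    mul_le_gapOp_hamiltonian hΦ hΨ hc h1 h2 (hγ.trans (iInf₂_le _ hΛ))

/-- The terms of an admissible interaction are uniformly comparable with their range projections. -/
lemma IsAdmissible.exists_comparable {G : SimpleGraph V} {R : ℝ} {Φ : Interaction V d}
    (hΦ : IsAdmissible G R Φ) : ∃ c c' : ℝ, 0 < c ∧ 0 < c' ∧ ∀ X,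
      (Φ X - (c : ℂ) • projected Φ X).PosSemidef ∧
      ((c' : ℂ) • projected Φ X - Φ X).PosSemidef := by
  obtain ⟨c, hc0, hc⟩ := EReal.lt_iff_exists_real_btwn.mp hΦ.phiMin_pos
  obtain ⟨c', hc', -⟩ := EReal.lt_iff_exists_real_btwn.mp hΦ.phiMax_lt_top
  have hn : ∀ X, ‖toCLM (Φ X)‖ ≤ c' := fun X => by
    rw [← EReal.coe_le_coe_iff]
    exact (le_iSup (fun X => ((‖toCLM (Φ X)‖ : ℝ) : EReal)) X).trans hc'.le
  refine ⟨c, c' + 1, by exact_mod_cast hc0, ?_, fun X => ?_⟩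
  · linarith [(norm_nonneg _).trans (hn ∅)]
  · by_cases h0 : Φ X = 0
    · have h3 : projected Φ X = 0 := by rw [projected, h0, rangeProj_zero]
      rw [h3, h0]
      simp [Matrix.PosSemidef.zero]
    · exact posSemidef_sub_rangeProj (hΦ.posSemidef X)
        (hc.le.trans (iInf₂_le (f := fun (X : Finset V) (_ : Φ X ≠ 0) => gapOp (Φ X)) X h0))
        ((hn X).trans (by linarith))

end Bridge

end

/-! ### Geometry of the embedding: bounded degree, blocks and cuts -/

section

open InnerProductSpace

section Geometry

variable {V : Type*} [DecidableEq V] {d D : ℕ} {G : SimpleGraph V} {C : ℝ}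
  {ι : V → EuclideanSpace ℝ (Fin D)}

-- Graph distances are integers, so a distance below `1` is `0`, and then `lower` and injectivity
-- identify the vertices. This also covers the value `0` that `G.dist` takes on disconnected pairs.
omit [DecidableEq V] in
lemma IsEuclideanEmbedding.eq_of_norm_lt (hι : IsEuclideanEmbedding G C ι) (hC : 0 < C) {i j : V}
    (h : ‖ι i - ι j‖ < C⁻¹) : i = j := by
  have h1 : (G.dist i j : ℝ) < 1 := by
    refine (hι.upper i j).trans_lt ?_
    calc C * ‖ι i - ι j‖ < C * C⁻¹ := by gcongr
      _ = 1 := mul_inv_cancel₀ hC.ne'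
  have h2 : G.dist i j = 0 := by
    have : G.dist i j < 1 := by exact_mod_cast h1
    omega
  have h3 := hι.lower i j
  rw [h2, Nat.cast_zero] at h3
  have h4 : ‖ι i - ι j‖ ≤ 0 := by
    by_contra hn
    push Not at hn
    have : 0 < C⁻¹ * ‖ι i - ι j‖ := by positivity
    linarith
  exact hι.injective (sub_eq_zero.mp (norm_le_zero_iff.mp h4))

omit [DecidableEq V] in
/-- Balls contain a uniformly bounded number of vertices. -/
lemma IsEuclideanEmbedding.exists_ball_card (hι : IsEuclideanEmbedding G C ι) (hC : 0 < C)
    (ρ : ℝ) : ∃ M : ℕ, ∀ v, ∃ S : Finset V, S.card ≤ M ∧ ∀ u, ‖ι u - ι v‖ ≤ ρ → u ∈ S := by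
  have hr : 0 < C⁻¹ / 2 := by positivity
  -- Each small ball holds at most one vertex, since vertices are `C⁻¹`-separated. Translating a
  -- single cover centred at `0` makes the count independent of `v`.
  obtain ⟨t, ht⟩ := (isCompact_closedBall (0 : EuclideanSpace ℝ (Fin D)) ρ).elim_nhds_subcover
    (fun x => Metric.ball x (C⁻¹ / 2)) fun x _ => Metric.ball_mem_nhds x hr
  refine ⟨t.card, fun v => ?_⟩
  have hex : ∀ u : {u // ‖ι u - ι v‖ ≤ ρ}, ∃ c : t, dist (ι u - ι v) c < C⁻¹ / 2 := by
    intro u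
    have h1 := ht.2 (show ι u - ι v ∈ Metric.closedBall 0 ρ by
      rw [mem_closedBall_zero_iff]; exact u.2)
    simp only [Set.mem_iUnion, Metric.mem_ball, exists_prop] at h1
    obtain ⟨c, hc, hc'⟩ := h1
    exact ⟨⟨c, hc⟩, hc'⟩
  choose f hf using hex
  have hinj : Function.Injective f := by
    intro u u' e
    have h1 := hf u
    have h2 := hf u'
    rw [← e] at h2
    have h3 := dist_triangle_right (ι u - ι v) (ι u' - ι v) (f u)
    rw [dist_eq_norm, sub_sub_sub_cancel_right] at h3
    exact Subtype.ext (hι.eq_of_norm_lt hC (by linarith))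
  have hfin : Finite {u // ‖ι u - ι v‖ ≤ ρ} := Finite.of_injective f hinj
  have hfin' : {u | ‖ι u - ι v‖ ≤ ρ}.Finite := hfin
  refine ⟨hfin'.toFinset, ?_, by simp⟩
  have h1 : Nat.card {u | ‖ι u - ι v‖ ≤ ρ} ≤ Nat.card t := Nat.card_le_card_of_injective f hinj
  rw [Nat.card_eq_card_finite_toFinset hfin'] at h1
  simpa using h1

/-- Sums of projections of finite range, with respect to the embedding. -/
structure IsLocalProj (ι : V → EuclideanSpace ℝ (Fin D)) (ρ : ℝ) (Ψ : Interaction V d) : Prop where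
  isStarProjection : ∀ X, IsStarProjection (Ψ X)
  empty : Ψ ∅ = 0
  norm_le : ∀ X, Ψ X ≠ 0 → ∀ u ∈ X, ∀ v ∈ X, ‖ι u - ι v‖ ≤ ρ

lemma IsLocalProj.nonempty {ρ : ℝ} {Ψ : Interaction V d} (hΨ : IsLocalProj ι ρ Ψ) {X : Finset V}
    (hX : Ψ X ≠ 0) : X.Nonempty := by
  by_contra h
  rw [Finset.not_nonempty_iff_eq_empty] at h
  subst h
  exact hX hΨ.empty

lemma IsLocalProj.abs_sub_le {ρ : ℝ} {Ψ : Interaction V d} (hΨ : IsLocalProj ι ρ Ψ)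
    {X : Finset V} (hX : Ψ X ≠ 0) {u v : V} (hu : u ∈ X) (hv : v ∈ X) (j : Fin D) :
    |ι u j - ι v j| ≤ ρ := by
  have h1 := PiLp.norm_apply_le (ι u - ι v) j
  rw [PiLp.sub_apply, Real.norm_eq_abs] at h1
  exact h1.trans (hΨ.norm_le X hX u hu v hv)

open Classical in
/-- Every interaction term fails to commute with a uniformly bounded number of others. -/
lemma IsLocalProj.exists_degree (hι : IsEuclideanEmbedding G C ι) (hC : 0 < C) {ρ : ℝ}
    {Ψ : Interaction V d} (hΨ : IsLocalProj ι ρ Ψ) : ∃ g : ℕ, 1 ≤ g ∧ ∀ Y, ∀ X ∈ activeSets Ψ Y,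
      ((activeSets Ψ Y).filter
        (fun X' => ¬ Commute (termOn Ψ Y X) (termOn Ψ Y X'))).card ≤ g := by
  obtain ⟨M, hM⟩ := hι.exists_ball_card hC (ρ + ρ)
  -- A term that does not commute with that of `X` meets `X`, so it is a subset of the at most `M`
  -- vertices within `2 ρ` of a fixed vertex of `X`.
  refine ⟨2 ^ M, Nat.one_le_two_pow, fun Y X hX => ?_⟩
  have hX0 := (mem_activeSets.mp hX).2
  obtain ⟨v, hv⟩ := hΨ.nonempty hX0
  obtain ⟨S, hS, hS'⟩ := hM v
  refine (Finset.card_le_card (t := S.powerset) fun X' hX' => ?_).trans ?_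
  · rw [Finset.mem_filter] at hX'
    have hX'0 := (mem_activeSets.mp hX'.1).2
    rw [Finset.mem_powerset]
    intro u hu
    have hd : ¬ Disjoint X X' := fun h => hX'.2 (commute_opOn h _ _)
    obtain ⟨z, hz, hz'⟩ := Finset.not_disjoint_iff.mp hd
    refine hS' u ?_
    calc ‖ι u - ι v‖ ≤ ‖ι u - ι z‖ + ‖ι z - ι v‖ := norm_sub_le_norm_sub_add_norm_sub _ _ _
      _ ≤ ρ + ρ := add_le_add (hΨ.norm_le X' hX'0 u hu z hz') (hΨ.norm_le X hX0 z hz v hv)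
  · rw [Finset.card_powerset]
    exact Nat.pow_le_pow_right (by norm_num) hS

open Classical in
/-- The block of length `3 ρ` along the axis `j` that contains a chosen vertex. -/
def blockIndex (ι : V → EuclideanSpace ℝ (Fin D)) (ρ : ℝ) (j : Fin D) (X : Finset V) : ℤ :=
  if h : X.Nonempty then ⌊ι h.choose j / (3 * ρ)⌋ else 0

/-- A term may stick out of its block by `ρ` on either side. Blocks of length `3 ρ > 2 ρ` thus make
terms two blocks apart disjoint. -/
lemma IsLocalProj.blockIndex_bounds {ρ : ℝ} (hρ : 0 < ρ) {Ψ : Interaction V d}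
    (hΨ : IsLocalProj ι ρ Ψ) (j : Fin D) {X : Finset V} (hX : Ψ X ≠ 0) {u : V} (hu : u ∈ X) :
    blockIndex ι ρ j X * (3 * ρ) - ρ ≤ ι u j ∧
      ι u j < (blockIndex ι ρ j X + 1) * (3 * ρ) + ρ := by
  have hne : X.Nonempty := ⟨u, hu⟩
  rw [blockIndex, dif_pos hne]
  have h1 := abs_le.mp (hΨ.abs_sub_le hX hu hne.choose_spec j)
  have h2 := Int.floor_le (ι hne.choose j / (3 * ρ))
  have h3 := Int.lt_floor_add_one (ι hne.choose j / (3 * ρ))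
  rw [le_div_iff₀ (by positivity)] at h2
  rw [div_lt_iff₀ (by positivity)] at h3
  constructor <;> linarith

/-- The vertices of `Y` with `j`-th coordinate less than `t`. -/
def lowerPart (ι : V → EuclideanSpace ℝ (Fin D)) (Y : Finset V) (j : Fin D) (t : ℝ) : Finset V :=
  open Classical in Y.filter fun u => ι u j < t

/-- The vertices of `Y` with `j`-th coordinate at least `t`. -/
def upperPart (ι : V → EuclideanSpace ℝ (Fin D)) (Y : Finset V) (j : Fin D) (t : ℝ) : Finset V :=
  open Classical in Y.filter fun u => t ≤ ι u j

omit [DecidableEq V] in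
lemma mem_lowerPart {Y : Finset V} {j : Fin D} {t : ℝ} {u : V} :
    u ∈ lowerPart ι Y j t ↔ u ∈ Y ∧ ι u j < t := by simp [lowerPart]

omit [DecidableEq V] in
lemma mem_upperPart {Y : Finset V} {j : Fin D} {t : ℝ} {u : V} :
    u ∈ upperPart ι Y j t ↔ u ∈ Y ∧ t ≤ ι u j := by simp [upperPart]

omit [DecidableEq V] in
lemma lowerPart_subset (ι : V → EuclideanSpace ℝ (Fin D)) (Y : Finset V) (j : Fin D) (t : ℝ) :
    lowerPart ι Y j t ⊆ Y := fun _ hu => (mem_lowerPart.mp hu).1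

omit [DecidableEq V] in
lemma upperPart_subset (ι : V → EuclideanSpace ℝ (Fin D)) (Y : Finset V) (j : Fin D) (t : ℝ) :
    upperPart ι Y j t ⊆ Y := fun _ hu => (mem_upperPart.mp hu).1

/-- Ground states of two overlapping parts of a region are almost orthogonal, off the ground states
of the region. -/
lemma IsLocalProj.norm_inner_le {ρ : ℝ} (hρ : 0 < ρ) {Ψ : Interaction V d}
    (hΨ : IsLocalProj ι ρ Ψ) {g : ℕ} (hg1 : 1 ≤ g)
    (hg : open Classical in ∀ Y, ∀ X ∈ activeSets Ψ Y, ((activeSets Ψ Y).filter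
        (fun X' => ¬ Commute (termOn Ψ Y X) (termOn Ψ Y X'))).card ≤ g)
    {Y : Finset V} {lam : ℝ} (hlam : 0 < lam) (hgap : (lam : EReal) ≤ gapOp (hamiltonian Ψ Y))
    (j : Fin D) (t w : ℝ) (n : ℕ) (hn : 3 * ρ * (4 * n + 2) ≤ w)
    {x y : EuclideanSpace ℂ (Config d Y)}
    (hx : x ∈ commonKer (termOn Ψ Y) (activeSets Ψ (lowerPart ι Y j (t + w))))
    (hy : y ∈ commonKer (termOn Ψ Y) (activeSets Ψ (upperPart ι Y j t)))
    (hyK : y ∈ (commonKer (termOn Ψ Y) (activeSets Ψ Y))ᗮ) :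
    ‖inner ℂ x y‖ ≤ 2 * Real.exp (-(n * √(lam / (g ^ 2 + lam)))) * (‖x‖ * ‖y‖) := by
  have h3ρ : 0 < 3 * ρ := by positivity
  -- With `β = ⌈(t + ρ) / (3 ρ)⌉`, terms in blocks from `β` on lie above `t`. Terms in blocks before
  -- `β + 4 n` lie below `t + 12 ρ n + 5 ρ`, hence below `t + w`.
  refine norm_inner_le_of_overlap (fun X => isStarProjection_opOn (hΨ.isStarProjection X))
    (activeSets Ψ Y) (blockIndex ι ρ j) ?_ (commonKer (termOn Ψ Y) (activeSets Ψ Y))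
    (fun x => mem_commonKer) lam hlam
    (fun x hx => gap_le_sum_activeSets hΨ.isStarProjection subset_rfl hgap hx) g hg1 (hg Y)
    ⌈(t + ρ) / (3 * ρ)⌉ n ?_ ?_ hyK
  · intro X hX X' hX' hb
    refine commute_opOn (Finset.disjoint_left.mpr fun u hu hu' => ?_) _ _
    have h1 := (hΨ.blockIndex_bounds hρ j (mem_activeSets.mp hX).2 hu).2
    have h2 := (hΨ.blockIndex_bounds hρ j (mem_activeSets.mp hX').2 hu').1
    have h3 : (blockIndex ι ρ j X : ℝ) + 2 ≤ blockIndex ι ρ j X' := by exact_mod_cast hb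
    nlinarith
  · intro X hX hb
    obtain ⟨hXY, hX0⟩ := mem_activeSets.mp hX
    refine mem_commonKer.mp hy X (mem_activeSets.mpr ⟨fun u hu => ?_, hX0⟩)
    refine mem_upperPart.mpr ⟨hXY hu, ?_⟩
    have h1 := (hΨ.blockIndex_bounds hρ j hX0 hu).1
    have h2 := Int.ceil_le.mp hb
    rw [div_le_iff₀ h3ρ] at h2
    linarith
  · intro X hX hb
    obtain ⟨hXY, hX0⟩ := mem_activeSets.mp hX
    refine mem_commonKer.mp hx X (mem_activeSets.mpr ⟨fun u hu => ?_, hX0⟩)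
    refine mem_lowerPart.mpr ⟨hXY hu, ?_⟩
    have h1 := (hΨ.blockIndex_bounds hρ j hX0 hu).2
    have h2 : (blockIndex ι ρ j X : ℝ) + 1 ≤ ⌈(t + ρ) / (3 * ρ)⌉ + 4 * n := by
      exact_mod_cast Int.add_one_le_of_lt hb
    have h3 := Int.ceil_lt_add_one ((t + ρ) / (3 * ρ))
    have h4 : (t + ρ) / (3 * ρ) * (3 * ρ) = t + ρ := div_mul_cancel₀ _ h3ρ.ne'
    nlinarith

/-- Cutting a region along the axis `j` in many ways. -/
lemma IsLocalProj.le_gapOp_of_cuts {ρ : ℝ} (hρ : 0 < ρ) {Ψ : Interaction V d}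
    (hΨ : IsLocalProj ι ρ Ψ) {g : ℕ} (hg1 : 1 ≤ g)
    (hg : open Classical in ∀ Y, ∀ X ∈ activeSets Ψ Y, ((activeSets Ψ Y).filter
        (fun X' => ¬ Commute (termOn Ψ Y X) (termOn Ψ Y X'))).card ≤ g)
    {Y : Finset V} {lam : ℝ} (hlam : 0 < lam) (hgap : (lam : EReal) ≤ gapOp (hamiltonian Ψ Y))
    (j : Fin D) (t w : ℝ) (hw : 0 ≤ w) (n : ℕ) (hn : 3 * ρ * (4 * n + 2) ≤ w) (N : ℕ)
    {γ : ℝ} (hγ : 0 ≤ γ)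
    (hA : ∀ i < N, (γ : EReal) ≤ gapOp (hamiltonian Ψ (lowerPart ι Y j (t + i * w + w))))
    (hB : ∀ i < N, (γ : EReal) ≤ gapOp (hamiltonian Ψ (upperPart ι Y j (t + i * w)))) :
    (((N / (N + 1) : ℝ) * (γ * (1 - 2 * Real.exp (-(n * √(lam / (g ^ 2 + lam)))))) : ℝ) : EReal)
      ≤ gapOp (hamiltonian Ψ Y) := by
  refine le_gapOp_hamiltonian hΨ.isStarProjection fun x hx => ?_
  have h1 := gap_step (activeSets Ψ Y) N
    (fun i => activeSets Ψ (lowerPart ι Y j (t + i * w + w)))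
    (fun i => activeSets Ψ (upperPart ι Y j (t + i * w)))
    (fun i _ => activeSets_mono Ψ (lowerPart_subset _ _ _ _))
    (fun i _ => activeSets_mono Ψ (upperPart_subset _ _ _ _)) ?_ hγ (by positivity)
    (fun i hi x hx => gap_le_sum_activeSets hΨ.isStarProjection (lowerPart_subset _ _ _ _)
      (hA i hi) hx)
    (fun i hi x hx => gap_le_sum_activeSets hΨ.isStarProjection (upperPart_subset _ _ _ _)
      (hB i hi) hx)
    (fun i _ x hx y hy hyK => hΨ.norm_inner_le hρ hg1 hg hlam hgap j _ w n hn hx hy hyK) hx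
  · have hN : (0 : ℝ) < N + 1 := by positivity
    rw [div_mul_eq_mul_div, div_mul_eq_mul_div, div_le_iff₀ hN]
    linarith
  -- A term in two overlaps would be nonempty with all its vertices in two disjoint slabs of width
  -- `w`.
  · intro i _ i' _ hii
    rw [Finset.disjoint_left]
    intro X hX hX'
    simp only [Finset.mem_inter, mem_activeSets] at hX hX'
    obtain ⟨u, hu⟩ := hΨ.nonempty hX.1.2
    have h1 := (mem_lowerPart.mp (hX.1.1 hu)).2
    have h2 := (mem_upperPart.mp (hX.2.1 hu)).2
    have h3 := (mem_lowerPart.mp (hX'.1.1 hu)).2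
    have h4 := (mem_upperPart.mp (hX'.2.1 hu)).2
    rcases lt_or_gt_of_ne hii with h | h
    · have h5 : (i : ℝ) + 1 ≤ i' := by exact_mod_cast h
      nlinarith
    · have h5 : (i' : ℝ) + 1 ≤ i := by exact_mod_cast h
      nlinarith

end Geometry

end

/-! ### Rectangles, summable losses and the recursion over scales -/

section

section Families

variable {V : Type*} {D : ℕ}

lemma scaleLength_pos (D k : ℕ) : 0 < scaleLength D k := Real.rpow_pos_of_pos (by norm_num) _

lemma scaleLength_add_self {D : ℕ} (hD : 1 ≤ D) (k : ℕ) :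
    scaleLength D (k + D) = 3 / 2 * scaleLength D k := by
  have hD0 : (D : ℝ) ≠ 0 := by positivity
  rw [scaleLength, scaleLength, Nat.cast_add, add_div, div_self hD0,
    Real.rpow_add (by norm_num), Real.rpow_one, mul_comm]

/-- The family in coordinates. -/
lemma mem_family_iff {ι : V → EuclideanSpace ℝ (Fin D)} {k : ℕ} {Λ : Finset V} :
    Λ ∈ family ι k ↔ ∃ (a : Fin D → ℝ) (π : Equiv.Perm (Fin D)), ∀ u ∈ Λ, ∀ j : Fin D,
      ι u (π j) - a j ∈ Set.Icc 0 (scaleLength D (k + ((j : ℕ) + 1))) := by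
  have hπ : ∀ (π : Equiv.Perm (Fin D)) (y : EuclideanSpace ℝ (Fin D)) (i : Fin D),
      LinearIsometryEquiv.piLpCongrLeft 2 ℝ ℝ π y i = y (π.symm i) := fun π y i => by
    rw [LinearIsometryEquiv.piLpCongrLeft_apply]
    rfl
  constructor
  · rintro ⟨a, π, h⟩
    refine ⟨fun j => a (π j), π, fun u hu j => ?_⟩
    obtain ⟨y, hy, e⟩ := h ⟨u, hu, rfl⟩
    rw [← e]
    have h1 := hy j
    simpa [hπ] using h1
  · rintro ⟨a, π, h⟩
    refine ⟨WithLp.toLp 2 fun i => a (π.symm i), π, ?_⟩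
    rintro _ ⟨u, hu, rfl⟩
    refine ⟨WithLp.toLp 2 fun j => ι u (π j) - a j, fun j => h u hu j, ?_⟩
    ext i
    simp [hπ]

/-- Cutting a rectangle of one scale along its longest side gives rectangles of the previous
scale. -/
lemma exists_cut_axis {ι : V → EuclideanSpace ℝ (Fin D)} (hD : 1 ≤ D) {k : ℕ} {Λ : Finset V}
    (hΛ : Λ ∈ family ι (k + 1)) : ∃ (j : Fin D) (a : ℝ),
      (∀ t ≤ scaleLength D (k + 1), lowerPart ι Λ j (a + t) ∈ family ι k) ∧
      (∀ t, scaleLength D (k + 1) / 2 ≤ t → upperPart ι Λ j (a + t) ∈ family ι k) := by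
  obtain ⟨m, rfl⟩ : ∃ m, D = m + 1 := ⟨D - 1, by omega⟩
  rw [mem_family_iff] at hΛ
  obtain ⟨a, π, h⟩ := hΛ
  set l := scaleLength (m + 1) (k + 1) with hl
  have hlast : scaleLength (m + 1) (k + 1 + ((Fin.last m : Fin (m + 1)) + 1)) = 3 / 2 * l := by
    rw [Fin.val_last, hl, scaleLength_add_self (by omega)]
  -- `R(k+1)` and `R(k)` share all sides but one: the last side of `R(k+1)`, once cut down to `l`,
  -- becomes the first side of `R(k)`. Hence the cyclic shift.
  set π' : Equiv.Perm (Fin (m + 1)) := (finRotate (m + 1)).symm.trans π with hπ'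
  have h0 : π' 0 = π (Fin.last m) := by
    rw [hπ', Equiv.trans_apply]
    congr 1
  have hs : ∀ i : Fin m, π' i.succ = π i.castSucc := fun i => by
    rw [hπ', Equiv.trans_apply]
    congr 1
    rw [Equiv.symm_apply_eq, finRotate_apply, Fin.coeSucc_eq_succ]
  have key : ∀ (S : Finset V) (t : ℝ), (∀ u ∈ S, u ∈ Λ) →
      (∀ u ∈ S, ι u (π (Fin.last m)) - (a (Fin.last m) + t) ∈ Set.Icc 0 l) →
      S ∈ family ι k := by
    intro S t hS hSt
    rw [mem_family_iff]
    refine ⟨Fin.cons (a (Fin.last m) + t) fun i => a i.castSucc, π', fun u hu j => ?_⟩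
    refine Fin.cases ?_ (fun i => ?_) j
    · rw [h0, Fin.cons_zero]
      exact hSt u hu
    · rw [hs, Fin.cons_succ]
      have h1 := h u (hS u hu) i.castSucc
      have h2 : k + 1 + ((i.castSucc : Fin (m + 1)) + 1 : ℕ) = k + ((i.succ : Fin (m + 1)) + 1) := by
        rw [Fin.val_castSucc, Fin.val_succ]
        ring
      rwa [h2] at h1
  refine ⟨π (Fin.last m), a (Fin.last m), fun t ht => ?_, fun t ht => ?_⟩
  · refine key _ 0 (fun u hu => (mem_lowerPart.mp hu).1) fun u hu => ?_
    obtain ⟨hu1, hu2⟩ := mem_lowerPart.mp hu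
    have h1 := (h u hu1 (Fin.last m)).1
    constructor <;> linarith
  · refine key _ t (fun u hu => (mem_upperPart.mp hu).1) fun u hu => ?_
    obtain ⟨hu1, hu2⟩ := mem_upperPart.mp hu
    have h1 := (h u hu1 (Fin.last m)).2
    rw [hlast] at h1
    constructor <;> linarith

end Families

/-- A sequence of lower bounds that loses a summable relative amount in each step stays away from
zero. -/
lemma exists_pos_of_summable_loss {P : ℕ → ℝ → Prop} (hmono : ∀ k a b, a ≤ b → P k b → P k a)
    {lam x : ℕ → ℝ} (hlam : ∀ k, 1 ≤ k → 0 < lam k) (hP : ∀ k, 1 ≤ k → P k (lam k))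
    (hx : Summable x) (hx0 : ∀ k, 1 ≤ k → 0 ≤ x k) (k0 : ℕ)
    (hstep : ∀ k, k0 ≤ k → ∀ γ, 0 ≤ γ → P k γ → P (k + 1) ((1 - x (k + 1)) * γ)) :
    ∃ c, 0 < c ∧ ∀ k, 1 ≤ k → P k c := by
  obtain ⟨s, hs⟩ := summable_iff_vanishing_norm.mp hx (1 / 2) (by norm_num)
  set k1 := max 1 (max k0 (s.sup id)) with hk1
  have h1 : 1 ≤ k1 := le_max_left _ _
  have h0 : k0 ≤ k1 := (le_max_left _ _).trans (le_max_right _ _)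
  have hsum : ∀ k, ∑ j ∈ Finset.Ioc k1 k, x j ≤ 1 / 2 := fun k => by
    refine (le_abs_self _).trans (hs (Finset.Ioc k1 k) ?_).le
    rw [Finset.disjoint_left]
    intro j hj hjs
    have h2 : j ≤ s.sup id := Finset.le_sup (f := id) hjs
    have h3 : s.sup id ≤ k1 := (le_max_right _ _).trans (le_max_right _ _)
    have := (Finset.mem_Ioc.mp hj).1
    omega
  -- The inequality `∏ (1 - x j) ≥ 1 - ∑ x j` in inductive form. Beyond `k1` the sums are at most
  -- `1/2`, so half of `lam k1` survives; the finitely many earlier scales are handled by a minimum.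
  have hlarge : ∀ k, k1 ≤ k → P k ((1 - ∑ j ∈ Finset.Ioc k1 k, x j) * lam k1) := by
    intro k hk
    induction k, hk using Nat.le_induction with
    | base => simpa using hP k1 h1
    | succ k hk ih =>
      have hl := (hlam k1 h1).le
      have h2 := hstep k (h0.trans hk) _
        (mul_nonneg (by linarith [hsum k]) hl) ih
      refine hmono _ _ _ ?_ h2
      rw [← Finset.sum_Ioc_consecutive x hk (Nat.le_succ k), Nat.Ioc_succ_singleton,
        Finset.sum_singleton, ← mul_assoc]
      gcongr
      have h3 : 0 ≤ ∑ j ∈ Finset.Ioc k1 k, x j :=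
        Finset.sum_nonneg fun j hj => hx0 j (by have := (Finset.mem_Ioc.mp hj).1; omega)
      nlinarith [hx0 (k + 1) (by omega)]
  obtain ⟨m, hm, hmin⟩ := Finset.exists_min_image (Finset.Icc 1 k1) lam ⟨1, by simp [h1]⟩
  have hm1 : 0 < lam m := hlam m (Finset.mem_Icc.mp hm).1
  refine ⟨lam m / 2, by positivity, fun k hk => ?_⟩
  rcases le_total k k1 with h | h
  · refine hmono _ _ _ ?_ (hP k hk)
    linarith [hmin k (Finset.mem_Icc.mpr ⟨hk, h⟩)]
  · refine hmono _ _ _ ?_ (hlarge k h)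
    have h2 := hmin k1 (Finset.mem_Icc.mpr ⟨h1, le_rfl⟩)
    nlinarith [hsum k]

section Recursion

variable {V : Type*} [DecidableEq V] {d D : ℕ} {G : SimpleGraph V} {C : ℝ}
  {ι : V → EuclideanSpace ℝ (Fin D)}

/-- The a priori gap `lam (k + 1)` of the whole region is used only for the overlap bound. The gap
that is propagated is that of the parts at scale `k`. -/
lemma IsLocalProj.exists_pos_le_gapFamily (hD : 1 ≤ D) (hι : IsEuclideanEmbedding G C ι)
    (hC : 0 < C) {ρ : ℝ} (hρ : 0 < ρ) {Ψ : Interaction V d} (hΨ : IsLocalProj ι ρ Ψ)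
    {lam s : ℕ → ℝ} (hlam : ∀ k, 1 ≤ k → 0 < lam k ∧ lam k ≤ 1) (hs : ∀ k, 1 ≤ k → 0 < s k)
    (hsum : Summable fun k => 1 / s k) {c : ℝ} (hc : 0 < c)
    (hlim : ∀ᶠ k : ℕ in Filter.atTop, c ≤ √(lam k) * (scaleLength D k / (k * s k)))
    (hgap : ∀ k, 1 ≤ k → (lam k : EReal) ≤ gapFamily Ψ ι k) :
    ∃ γ : ℝ, 0 < γ ∧ ∀ k, 1 ≤ k → (γ : EReal) ≤ gapFamily Ψ ι k := by
  obtain ⟨g, hg1, hg⟩ := hΨ.exists_degree hι hC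
  have hg0 : (1 : ℝ) ≤ g := by exact_mod_cast hg1
  set κ : ℝ := c / (24 * ρ * (g + 1)) with hκ
  have hκ0 : 0 < κ := by positivity
  have hexp : Summable fun k : ℕ => 2 * Real.exp (3 / 2) * Real.exp (-κ * k) := by
    refine Summable.mul_left _ ?_
    have h1 : (fun k : ℕ => Real.exp (-κ * k)) = fun k : ℕ => Real.exp (-κ) ^ k := by
      ext k
      rw [← Real.exp_nat_mul, mul_comm]
    rw [h1]
    exact summable_geometric_of_lt_one (Real.exp_pos _).le (Real.exp_lt_one_iff.mpr (by linarith))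
  have hev : ∀ᶠ k : ℕ in Filter.atTop, 1 ≤ k ∧ 2 ≤ s k ∧ 6 * ρ ≤ c * k / 2 ∧
      c ≤ √(lam k) * (scaleLength D k / (k * s k)) := by
    have h1 : ∀ᶠ k : ℕ in Filter.atTop, 1 / s k < 1 / 2 :=
      hsum.tendsto_atTop_zero.eventually_lt_const (by norm_num)
    have h2 : ∀ᶠ k : ℕ in Filter.atTop, 12 * ρ / c ≤ k :=
      tendsto_natCast_atTop_atTop.eventually_ge_atTop _
    filter_upwards [h1, h2, hlim, Filter.eventually_ge_atTop 1] with k h1 h2 h3 h4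
    refine ⟨h4, ?_, ?_, h3⟩
    · rw [one_div_lt_one_div (hs k h4) (by norm_num)] at h1
      exact h1.le
    · rw [div_le_iff₀ hc] at h2
      linarith
  obtain ⟨k0, hk0⟩ := Filter.eventually_atTop.mp hev
  refine exists_pos_of_summable_loss (P := fun k γ => (γ : EReal) ≤ gapFamily Ψ ι k)
    (fun k a b hab h => (EReal.coe_le_coe_iff.mpr hab).trans h) (fun k hk => (hlam k hk).1) hgap
    (hexp.add hsum) (fun k hk => by have := hs k hk; positivity) k0 ?_
  intro k hk γ hγ hPk
  refine le_iInf₂ fun Y hY => ?_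
  obtain ⟨j, a, hlow, hup⟩ := exists_cut_axis hD hY
  obtain ⟨hk1, hs2, hkρ, hkc⟩ := hk0 (k + 1) (by omega)
  obtain ⟨hl0, hl1⟩ := hlam (k + 1) hk1
  set K := k + 1 with hK
  set l := scaleLength D K with hl
  have hlpos : 0 < l := scaleLength_pos D K
  have hKpos : (0 : ℝ) < K := by exact_mod_cast hk1
  have hspos : 0 < s K := hs K hk1
  -- `N ≤ s K` keeps the overlaps wide, while `s K < N + 1` bounds the loss `1 / (N + 1)` by `1 / s
  -- K`.
  set N := ⌊s K⌋₊ with hN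
  have hNs : (N : ℝ) ≤ s K := Nat.floor_le hspos.le
  have hNs' : s K < N + 1 := Nat.lt_floor_add_one _
  have hN0 : (0 : ℝ) < N := by linarith
  set w := l / (2 * N) with hw
  have hw0 : 0 < w := by positivity
  have hNw : N * w = l / 2 := by rw [hw]; field_simp
  have hsq1 : √(lam K) ≤ 1 := Real.sqrt_le_one.mpr hl1
  have hsq0 : 0 < √(lam K) := Real.sqrt_pos.mpr hl0
  have hwl : c * K / 2 ≤ √(lam K) * w := by
    have h1 : l / (2 * s K) ≤ w := by
      rw [hw]; gcongr
    calc c * K / 2 ≤ √(lam K) * (l / (K * s K)) * K / 2 := by gcongr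
      _ = √(lam K) * (l / (2 * s K)) := by field_simp
      _ ≤ _ := by gcongr
  have hwρ : 6 * ρ ≤ w := by nlinarith
  -- The largest degree allowed by `3 ρ (4 n + 2) ≤ w`. It exceeds `w / (12 ρ) - 3/2`, which is the
  -- source of the constant `exp (3/2)`.
  set n := ⌊(w / (3 * ρ) - 2) / 4⌋₊ with hn
  have hw3 : w / (3 * ρ) * (3 * ρ) = w := div_mul_cancel₀ _ (by positivity)
  have hn0 : 0 ≤ (w / (3 * ρ) - 2) / 4 := by
    have : 2 ≤ w / (3 * ρ) := by
      rw [le_div_iff₀ (by positivity)]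
      linarith
    linarith
  have hn1 : (n : ℝ) ≤ (w / (3 * ρ) - 2) / 4 := Nat.floor_le hn0
  have hn2 : (w / (3 * ρ) - 2) / 4 < n + 1 := Nat.lt_floor_add_one _
  have hnw : 3 * ρ * (4 * n + 2) ≤ w := by nlinarith
  have hstep := hΨ.le_gapOp_of_cuts hρ hg1 hg hl0 ((hgap K hk1).trans (iInf₂_le Y hY)) j
    (a + l / 2) w hw0.le n hnw N hγ
    (fun i hi => by
      refine hPk.trans (iInf₂_le _ ?_)
      have h1 : (i : ℝ) + 1 ≤ N := by exact_mod_cast hi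
      have h2 : a + l / 2 + i * w + w = a + (l / 2 + i * w + w) := by ring
      rw [h2]
      exact hlow _ (by nlinarith))
    (fun i hi => by
      refine hPk.trans (iInf₂_le _ ?_)
      have h2 : a + l / 2 + i * w = a + (l / 2 + i * w) := by ring
      rw [h2]
      exact hup _ (by nlinarith [mul_nonneg (Nat.cast_nonneg (α := ℝ) i) hw0.le]))
  refine (EReal.coe_le_coe_iff.mpr ?_).trans hstep
  -- Uses `g² + lam K ≤ (g + 1)²`, valid since `lam K ≤ 1`.
  have hη : √(lam K) / (g + 1) ≤ √(lam K / (g ^ 2 + lam K)) := by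
    rw [Real.sqrt_div hl0.le]
    gcongr
    rw [Real.sqrt_le_left (by positivity)]
    nlinarith
  have hη1 : √(lam K) / (g + 1) ≤ 1 := by
    rw [div_le_one (by positivity)]
    linarith
  have hrate : κ * K - 3 / 2 ≤ n * √(lam K / (g ^ 2 + lam K)) := by
    have h1 : κ * K ≤ w / (12 * ρ) * (√(lam K) / (g + 1)) := by
      calc κ * K = (c * K / 2) / (12 * ρ * (g + 1)) := by rw [hκ]; field_simp; ring
        _ ≤ (√(lam K) * w) / (12 * ρ * (g + 1)) := by gcongr
        _ = _ := by field_simp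
    have h2 : w / (12 * ρ) - 3 / 2 ≤ n := by
      have : w / (12 * ρ) = w / (3 * ρ) / 4 := by field_simp; norm_num
      linarith
    have h3 : 0 ≤ √(lam K) / (g + 1) := by positivity
    calc κ * K - 3 / 2 ≤ w / (12 * ρ) * (√(lam K) / (g + 1)) - 3 / 2 * (√(lam K) / (g + 1)) := by
          linarith
      _ = (w / (12 * ρ) - 3 / 2) * (√(lam K) / (g + 1)) := by ring
      _ ≤ n * (√(lam K) / (g + 1)) := by gcongr
      _ ≤ _ := by gcongr
  set δ := 2 * Real.exp (-(n * √(lam K / (g ^ 2 + lam K)))) with hδ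
  have hδ0 : 0 < δ := by positivity
  have hδ1 : δ ≤ 2 * Real.exp (3 / 2) * Real.exp (-κ * K) := by
    rw [hδ, mul_assoc, ← Real.exp_add]
    gcongr
    linarith
  have hN1 : (1 : ℝ) / (N + 1) ≤ 1 / s K := by gcongr
  have hNN : (N : ℝ) / (N + 1) = 1 - 1 / (N + 1) := by field_simp; ring
  rw [hNN, mul_left_comm, mul_comm _ γ]
  gcongr
  have h5 : 0 ≤ 1 / ((N : ℝ) + 1) * δ := by positivity
  linarith

end Recursion

end

/-! ### Reduction to projections and conclusion -/

section

section Main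

variable {V : Type*} [DecidableEq V] {d D : ℕ} {G : SimpleGraph V} {C R : ℝ}
  {ι : V → EuclideanSpace ℝ (Fin D)}

lemma posSemidef_projected (Φ : Interaction V d) (X : Finset V) : (projected Φ X).PosSemidef :=
  posSemidef_of_isStarProjection (isStarProjection_rangeProj _)

/-- Frustration-freeness excludes a scalar term on the empty region. -/
lemma IsFrustrationFree.empty {Φ : Interaction V d} (hFF : IsFrustrationFree Φ) : Φ ∅ = 0 := by
  have h1 : hamiltonian Φ ∅ = Φ ∅ := by
    apply EquivLike.injective (Matrix.toEuclideanCLM (𝕜 := ℂ))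
    change toCLM _ = toCLM _
    rw [toCLM_hamiltonian, Finset.powerset_empty, Finset.sum_singleton,
      opOn_of_subset subset_rfl, extend_self]
  have h2 := hFF ∅
  rw [h1, Submodule.ne_bot_iff] at h2
  obtain ⟨v, hv, hv0⟩ := h2
  have h3 : (Φ ∅).mulVec v.ofLp = 0 := congrArg WithLp.ofLp (LinearMap.mem_ker.mp hv)
  ext σ τ
  have h4 := congrFun h3 σ
  -- The empty region has a single configuration, so `Φ ∅` is a scalar that annihilates a nonzero
  -- vector.
  rw [Matrix.mulVec, dotProduct, Fintype.sum_unique] at h4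
  have h5 : v.ofLp default ≠ 0 := by
    intro h5
    apply hv0
    ext i
    rw [Subsingleton.elim i default, h5]
    rfl
  rw [Subsingleton.elim τ default]
  exact (mul_eq_zero.mp h4).resolve_right h5

/-- Frustration-freeness enters here, to discard the empty region, which has no position along an
axis. -/
lemma IsAdmissible.isLocalProj {Φ : Interaction V d} (hΦ : IsAdmissible G R Φ)
    (hι : IsEuclideanEmbedding G C ι) (hC : 0 < C) (hFF : IsFrustrationFree Φ) :
    IsLocalProj ι (C * R) (projected Φ) where
  isStarProjection X := isStarProjection_rangeProj _
  empty := by rw [projected, hFF.empty, rangeProj_zero]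
  norm_le X hX u hu v hv := by
    have h0 : Φ X ≠ 0 := fun h => hX (by rw [projected, h, rangeProj_zero])
    have h1 : (graphDiam G X : ℝ) ≤ R := not_lt.mp fun h => h0 (hΦ.finite_range X h)
    have h2 : G.dist u v ≤ graphDiam G X :=
      Finset.le_sup (f := fun p : V × V => G.dist p.1 p.2) (b := (u, v))
        (Finset.mk_mem_product hu hv)
    have h3 : (G.dist u v : ℝ) ≤ R := (Nat.cast_le.mpr h2).trans h1
    have h4 := (hι.lower u v).trans h3
    rwa [inv_mul_le_iff₀ hC] at h4

lemma gapInfinite_pos {Φ : Interaction V d} {γ : ℝ} (hγ : 0 < γ)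
    (h : ∀ k, 1 ≤ k → (γ : EReal) ≤ gapFamily Φ ι k) : 0 < gapInfinite Φ ι :=
  lt_of_lt_of_le (EReal.coe_pos.mpr hγ) (le_iInf₂ h)

/-- Positivity of both gaps from local gaps of the projected interaction. -/
lemma gapInfinite_pos_of_projected (hD : 1 ≤ D) (hι : IsEuclideanEmbedding G C ι) (hC : 0 < C)
    (hR : 0 < R) {Φ : Interaction V d} (hΦ : IsAdmissible G R Φ) (hFF : IsFrustrationFree Φ)
    {lam s : ℕ → ℝ} (hlam : ∀ k, 1 ≤ k → 0 < lam k ∧ lam k ≤ 1) (hs : ∀ k, 1 ≤ k → 0 < s k)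
    (hsum : Summable fun k => 1 / s k) {c : ℝ} (hc : 0 < c)
    (hlim : ∀ᶠ k : ℕ in Filter.atTop, c ≤ √(lam k) * (scaleLength D k / (k * s k)))
    (hgap : ∀ k, 1 ≤ k → (lam k : EReal) ≤ gapFamily (projected Φ) ι k) :
    0 < gapInfinite Φ ι ∧ 0 < gapInfinite (projected Φ) ι := by
  obtain ⟨γ, hγ, h⟩ := (hΦ.isLocalProj hι hC hFF).exists_pos_le_gapFamily hD hι hC
    (mul_pos hC hR) hlam hs hsum hc hlim hgap
  obtain ⟨a, a', ha, -, hcomp⟩ := hΦ.exists_comparable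
  refine ⟨gapInfinite_pos (mul_pos ha hγ) fun k hk => ?_, gapInfinite_pos hγ h⟩
  exact mul_le_gapFamily hΦ.posSemidef (posSemidef_projected Φ) ha.le (fun X => (hcomp X).1)
    (fun X => (hcomp X).2) ι (h k hk)

end Main

end

end SpinSystem

end

theorem mainTheorem2 {V : Type*} [DecidableEq V] (G : SimpleGraph V)
    (D : ℕ) (hD : 1 ≤ D) (C : ℝ) (hC : 1 ≤ C)
    (ι : V → EuclideanSpace ℝ (Fin D)) (hι : SpinSystem.IsEuclideanEmbedding G C ι)
    (d : ℕ) (Φ : SpinSystem.Interaction V d)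
    (R : ℝ) (hR : 0 < R) (hΦ : SpinSystem.IsAdmissible G R Φ)
    (hFF : SpinSystem.IsFrustrationFree Φ)
    (lam s : ℕ → ℝ)
    (hlam : ∀ k : ℕ, 1 ≤ k → 0 < lam k ∧ lam k < 1)
    (hs : ∀ k : ℕ, 1 ≤ k → 0 < s k)
    (hsum : Summable (fun k : ℕ => 1 / s k))
    (hlim : 0 < Filter.liminf
      (fun k : ℕ =>
        ((√(lam k) * (SpinSystem.scaleLength D k / ((k : ℝ) * s k)) : ℝ) : EReal))
      Filter.atTop) :
    -- the Hamiltonians of `Φ` itself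
    ((∀ k : ℕ, 1 ≤ k → (lam k : EReal) ≤ SpinSystem.gapFamily Φ ι k) →
      0 < SpinSystem.gapInfinite Φ ι ∧
      0 < SpinSystem.gapInfinite (SpinSystem.projected Φ) ι) ∧
    -- the Hamiltonians that are sums of projections
    ((∀ k : ℕ, 1 ≤ k →
        (lam k : EReal) ≤ SpinSystem.gapFamily (SpinSystem.projected Φ) ι k) →
      0 < SpinSystem.gapInfinite Φ ι ∧
      0 < SpinSystem.gapInfinite (SpinSystem.projected Φ) ι) := by
  have hC0 : 0 < C := by linarith
  obtain ⟨c, hc0, hc⟩ := EReal.lt_iff_exists_real_btwn.mp hlim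
  have hc0 : 0 < c := by exact_mod_cast hc0
  have hev : ∀ᶠ k : ℕ in Filter.atTop, c ≤ √(lam k) * (SpinSystem.scaleLength D k / ((k : ℝ) * s k)) := by
    filter_upwards [Filter.eventually_lt_of_lt_liminf hc] with k hk
    exact (EReal.coe_lt_coe_iff.mp hk).le
  constructor
  · intro hgap
    obtain ⟨a, a', ha, ha', hcomp⟩ := hΦ.exists_comparable
    -- The projections dominate `a'⁻¹ • Φ X`, so their gaps are at least `b * lam k`. The minimum
    -- with `1` keeps this at most `1`, and the liminf condition only loses a factor `√b`.
    set b : ℝ := min a'⁻¹ 1 with hb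
    have hb0 : 0 < b := by positivity
    have hb1 : b ≤ 1 := min_le_right _ _
    have hba : b * a' ≤ 1 := by
      calc b * a' ≤ a'⁻¹ * a' := by gcongr; exact min_le_left _ _
        _ = 1 := inv_mul_cancel₀ ha'.ne'
    refine SpinSystem.gapInfinite_pos_of_projected hD hι hC0 hR hΦ hFF (lam := fun k => b * lam k)
      (fun k hk => ⟨mul_pos hb0 (hlam k hk).1, ?_⟩) hs hsum (c := √b * c) (by positivity) ?_ ?_
    · nlinarith [hlam k hk]
    · filter_upwards [hev] with k hk
      rw [Real.sqrt_mul hb0.le, mul_assoc]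
      gcongr
    · intro k hk
      refine SpinSystem.mul_le_gapFamily (c' := a⁻¹) (SpinSystem.posSemidef_projected Φ) hΦ.posSemidef hb0.le
        (fun X => ?_) (fun X => ?_) ι (hgap k hk)
      · have h1 : SpinSystem.projected Φ X - (b : ℂ) • Φ X = ((1 - b * a' : ℝ) : ℂ) • SpinSystem.projected Φ X +
            (b : ℂ) • ((a' : ℂ) • SpinSystem.projected Φ X - Φ X) := by
          push_cast
          module
        rw [h1]
        refine ((SpinSystem.posSemidef_projected Φ X).smul ?_).add ((hcomp X).2.smul ?_)
        · exact_mod_cast sub_nonneg.mpr hba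
        · exact_mod_cast hb0.le
      · have h1 : ((a⁻¹ : ℝ) : ℂ) • Φ X - SpinSystem.projected Φ X =
            ((a⁻¹ : ℝ) : ℂ) • (Φ X - (a : ℂ) • SpinSystem.projected Φ X) := by
          rw [smul_sub, smul_smul, ← Complex.ofReal_mul, inv_mul_cancel₀ ha.ne', Complex.ofReal_one,
            one_smul]
        rw [h1]
        refine (hcomp X).1.smul ?_
        exact_mod_cast (inv_pos.mpr ha).le
  · intro hgap
    exact SpinSystem.gapInfinite_pos_of_projected hD hι hC0 hR hΦ hFF
      (fun k hk => ⟨(hlam k hk).1, (hlam k hk).2.le⟩) hs hsum hc0 hev hgap
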